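/- **Proposition (2-Bianchi identity).** Let $\mathcal G=(\partial\colon E\to G,\triangleright)$ be a Lie crossed module of finite-dimensional Lie groups: $\partial$ is a smooth morphism and $\triangleright$ a smooth left action of $G$ on $E$ by automorphisms, with $\partial(g\triangleright e)=g\,\partial(e)\,g^{-1}$ and $\partial(e)\triangleright f=efe^{-1}$. Denote also by $\partial\colon\mathfrak e\to\mathfrak g$ and $\triangleright\colon\mathfrak g\times\mathfrak e\to\mathfrak e$ the induced map of Lie algebras and the derived action. Let $\pi\colon P\to M$ be a smooth principal $G$-bundle with right translations $R_g$ and fundamental vector fields $A^\#$ ($A\in\mathfrak g$), and let $(\omega,m)$ be a $\mathcal G$-categorical connection on $P$, that is: * $\omega$ is a smooth $\mathfrak g$-valued $1$-form on $P$ with $R_g^*\omega=g^{-1}\omega g$ for all $g\in G$ and $\omega(A^\#)=A$ for all $A\in\mathfrak g$; write $X\mapsto X^H$ for the projection of $TP$ onto $\ker\omega$ along $\ker \pi_*$, and for a form $a$ put $Da=da\circ(H\times\cdots\times H)$, where $H\colon X\mapsto X^H$; * $m$ is a smooth $\mathfrak e$-valued $2$-form on $P$ with $R_g^*m=g^{-1}\triangleright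 m$ for all $g\in G$ and $m(X,Y)=m(X^H,Y^H)$ for all $X,Y$; * $\partial(m)=\Omega$, where $\Omega=D\omega$ is the curvature of $\omega$. For a $\mathfrak g$-valued $p$-form $a$ and an $\mathfrak e$-valued $q$-form $b$ put $a\wedge^{\triangleright}b=\frac{(p+q)!}{p!\,q!}\operatorname{Alt}(a\otimes^{\triangleright}b)$, where $(a\otimes^\triangleright b)(A_1,\dots,A_p,B_1,\dots,B_q)=a(A_1,\dots,A_p)\triangleright b(B_1,\dots,B_q)$ and $\operatorname{Alt}$ is the projection onto alternating tensors. Let $\mathcal M=Dm=dm\circ(H\times H\times H)$ be the 2-curvature 3-form of $(\omega,m)$. Then $\mathcal M$ is a smooth $\mathfrak e$-valued $3$-form on $P$, its exterior covariant derivative vanishes, $$D\mathcal M=d\mathcal M\circ(H\times H\times H\times H)=0,$$ and, equivalently, $$d\mathcal M+\omega\wedge^{\triangleright}\mathcal M=0.$$ -/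

import Mathlib

open scoped Manifold ContDiff Nat

noncomputable section

/-! ### Vector-valued differential forms on a manifold -/

section Forms

variable {V : Type*} [NormedAddCommGroup V] [NormedSpace ℝ V]
  {H : Type*} [TopologicalSpace H] (I : ModelWithCorners ℝ V H)
  (P : Type*) [TopologicalSpace P] [ChartedSpace H P]
  (F : Type*) [NormedAddCommGroup F] [NormedSpace ℝ F]

/-- `F`-valued differential `n`-forms on `P` (no regularity is imposed here). -/
abbrev DForm (n : ℕ) : Type _ := (p : P) → TangentSpace I p [⋀^Fin n]→L[ℝ] F

variable {I P F} {n : ℕ}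

/-- The expression of the form `a` in the preferred chart at `x₀`, i.e. its pullback under the
inverse of that chart. -/
def DForm.inChart (a : DForm I P F n) (x₀ : P) : V → V [⋀^Fin n]→L[ℝ] F := fun y =>
  (a ((extChartAt I x₀).symm y)).compContinuousLinearMap
    (mfderivWithin 𝓘(ℝ, V) I (extChartAt I x₀).symm (Set.range I) y)

/-- A form is smooth if it is smooth in charts. -/
def DForm.IsSmooth (a : DForm I P F n) : Prop :=
  ∀ x₀ : P, ContDiffOn ℝ ∞ (a.inChart x₀) (extChartAt I x₀).target

/-- The exterior derivative `d a`, computed at the point `x` in the preferred chart at `x`. -/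
def DForm.d (a : DForm I P F n) : DForm I P F (n + 1) := fun x =>
  (extDerivWithin (a.inChart x) (Set.range I) (extChartAt I x x)).compContinuousLinearMap
    (mfderiv I 𝓘(ℝ, V) (extChartAt I x) x)

end Forms

section Wedge

variable {T : Type*} [AddCommGroup T] [Module ℝ T] [TopologicalSpace T]
  {F₁ F₂ F₃ : Type*} [NormedAddCommGroup F₁] [NormedSpace ℝ F₁]
  [NormedAddCommGroup F₂] [NormedSpace ℝ F₂] [NormedAddCommGroup F₃] [NormedSpace ℝ F₃]
  {n m : ℕ}

/-- The tensor `(A₁,…,Aₙ,B₁,…,Bₘ) ↦ β (a (A₁,…,Aₙ)) (b (B₁,…,Bₘ))`. -/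
def tensorAlong (β : F₁ →L[ℝ] F₂ →L[ℝ] F₃) (a : T [⋀^Fin n]→L[ℝ] F₁) (b : T [⋀^Fin m]→L[ℝ] F₂) :
    ContinuousMultilinearMap ℝ (fun _ : Fin (n + m) => T) F₃ where
  toFun v := β (a fun i => v (Fin.castAdd m i)) (b fun j => v (Fin.natAdd n j))
  map_update_add' := by
    intro _ v i x y
    induction i using Fin.addCases with
    | left i =>
      have h₁ : ∀ z : T, (fun k => Function.update v (Fin.castAdd m i) z (Fin.castAdd m k)) =
          Function.update (fun k => v (Fin.castAdd m k)) i z := fun z =>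
        funext fun k => by by_cases hk : k = i <;> simp [hk]
      have h₂ : ∀ z : T, (fun k => Function.update v (Fin.castAdd m i) z (Fin.natAdd n k)) =
          fun k => v (Fin.natAdd n k) := fun z =>
        funext fun k => by
          have : Fin.natAdd n k ≠ Fin.castAdd m i := fun h => by
            have := congrArg Fin.val h; simp at this; omega
          simp [this]
      simp [h₁, h₂]
    | right i =>
      have h₁ : ∀ z : T, (fun k => Function.update v (Fin.natAdd n i) z (Fin.natAdd n k)) =
          Function.update (fun k => v (Fin.natAdd n k)) i z := fun z =>
        funext fun k => by by_cases hk : k = i <;> simp [hk]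
      have h₂ : ∀ z : T, (fun k => Function.update v (Fin.natAdd n i) z (Fin.castAdd m k)) =
          fun k => v (Fin.castAdd m k) := fun z =>
        funext fun k => by
          have : Fin.castAdd m k ≠ Fin.natAdd n i := fun h => by
            have := congrArg Fin.val h; simp at this; omega
          simp [this]
      simp [h₁, h₂]
  map_update_smul' := by
    intro _ v i c x
    induction i using Fin.addCases with
    | left i =>
      have h₁ : ∀ z : T, (fun k => Function.update v (Fin.castAdd m i) z (Fin.castAdd m k)) =
          Function.update (fun k => v (Fin.castAdd m k)) i z := fun z =>
        funext fun k => by by_cases hk : k = i <;> simp [hk]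
      have h₂ : ∀ z : T, (fun k => Function.update v (Fin.castAdd m i) z (Fin.natAdd n k)) =
          fun k => v (Fin.natAdd n k) := fun z =>
        funext fun k => by
          have : Fin.natAdd n k ≠ Fin.castAdd m i := fun h => by
            have := congrArg Fin.val h; simp at this; omega
          simp [this]
      simp [h₁, h₂]
    | right i =>
      have h₁ : ∀ z : T, (fun k => Function.update v (Fin.natAdd n i) z (Fin.natAdd n k)) =
          Function.update (fun k => v (Fin.natAdd n k)) i z := fun z =>
        funext fun k => by by_cases hk : k = i <;> simp [hk]
      have h₂ : ∀ z : T, (fun k => Function.update v (Fin.natAdd n i) z (Fin.castAdd m k)) =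
          fun k => v (Fin.castAdd m k) := fun z =>
        funext fun k => by
          have : Fin.castAdd m k ≠ Fin.natAdd n i := fun h => by
            have := congrArg Fin.val h; simp at this; omega
          simp [this]
      simp [h₁, h₂]
  cont := by
    change Continuous fun v : Fin (n + m) → T => _
    have h₁ : Continuous fun v : Fin (n + m) → T => a fun i => v (Fin.castAdd m i) :=
      a.cont.comp (by fun_prop)
    have h₂ : Continuous fun v : Fin (n + m) → T => b fun j => v (Fin.natAdd n j) :=
      b.cont.comp (by fun_prop)
    exact (β.continuous.comp h₁).clm_apply h₂

/-- The wedge product of two alternating maps along a bilinear map `β`: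
`(n+m)! / (n! m!) • Alt (a ⊗ b)`, where `Alt` is the projection
`(1 / (n+m)!) ∑ σ, sign σ • (· ∘ σ)`. -/
def wedgeAlong (β : F₁ →L[ℝ] F₂ →L[ℝ] F₃) (a : T [⋀^Fin n]→L[ℝ] F₁) (b : T [⋀^Fin m]→L[ℝ] F₂) :
    T [⋀^Fin (n + m)]→L[ℝ] F₃ :=
  (((n + m)! : ℝ) / ((n ! : ℝ) * (m ! : ℝ))) •
    ((((n + m)! : ℝ)⁻¹) • ContinuousMultilinearMap.alternatization (tensorAlong β a b))

end Wedge

/-! ### Lie crossed modules -/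

section Groups

variable {VG : Type*} [NormedAddCommGroup VG] [NormedSpace ℝ VG]
  {HG : Type*} [TopologicalSpace HG] (IG : ModelWithCorners ℝ VG HG)
  {VE : Type*} [NormedAddCommGroup VE] [NormedSpace ℝ VE]
  {HE : Type*} [TopologicalSpace HE] (IE : ModelWithCorners ℝ VE HE)
  (G : Type*) [TopologicalSpace G] [ChartedSpace HG G] [Group G]
  (E : Type*) [TopologicalSpace E] [ChartedSpace HE E] [Group E]

/-- A Lie crossed module `(∂ : E → G, ▷)` on Lie groups `E` and `G`. -/
structure LieCrossedModule where
  /-- the morphism `∂` -/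
  bd : E →* G
  /-- the left action `▷` of `G` on `E` by automorphisms -/
  act : G →* MulAut E
  contMDiff_bd : ContMDiff IE IG ∞ bd
  contMDiff_act : ContMDiff (IG.prod IE) IE ∞ fun q : G × E => act q.1 q.2
  bd_act : ∀ (g : G) (e : E), bd (act g e) = g * bd e * g⁻¹
  act_bd : ∀ e f : E, act (bd e) f = e * f * e⁻¹

/-- The adjoint action `A ↦ g A g⁻¹` of `g` on the Lie algebra of `G`, the derivative at `1` of
conjugation by `g`. The Lie algebra `GroupLieAlgebra IG G = T₁G` is, by definition, carried by the
model vector space `VG`. -/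
def adjointAction {G : Type*} [TopologicalSpace G] [ChartedSpace HG G] [Group G] (g : G) :
    VG →L[ℝ] VG :=
  (mfderiv IG IG (fun x : G => g * x * g⁻¹) 1 : GroupLieAlgebra IG G →L[ℝ] _)

variable {IG IE G E}

namespace LieCrossedModule

/-- The map `∂ : 𝔢 → 𝔤` of Lie algebras induced by `∂ : E → G`. -/
def dBd (X : LieCrossedModule IG IE G E) : VE →L[ℝ] VG :=
  (mfderiv IE IG X.bd 1 : GroupLieAlgebra IE E →L[ℝ] _)

/-- The action of `g : G` on the Lie algebra `𝔢 = T₁E`: the derivative at `1` of `e ↦ g ▷ e`. -/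
def groupAct (X : LieCrossedModule IG IE G E) (g : G) : VE →L[ℝ] VE :=
  (mfderiv IE IE (fun e : E => X.act g e) 1 : GroupLieAlgebra IE E →L[ℝ] _)

/-- The derived action `▷ : 𝔤 × 𝔢 → 𝔢`: the derivative at `1` of `g ↦ (g ▷ ·) ∈ End 𝔢`. -/
def derivedAct (X : LieCrossedModule IG IE G E) : VG →L[ℝ] VE →L[ℝ] VE :=
  (mvfderiv IG (fun g : G => X.groupAct g) 1 : GroupLieAlgebra IG G →L[ℝ] _)

end LieCrossedModule

end Groups

/-! ### Principal bundles and categorical connections -/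

section Bundles

variable {VG : Type*} [NormedAddCommGroup VG] [NormedSpace ℝ VG]
  {HG : Type*} [TopologicalSpace HG] (IG : ModelWithCorners ℝ VG HG)
  {VE : Type*} [NormedAddCommGroup VE] [NormedSpace ℝ VE]
  {HE : Type*} [TopologicalSpace HE] (IE : ModelWithCorners ℝ VE HE)
  {VM : Type*} [NormedAddCommGroup VM] [NormedSpace ℝ VM]
  {HM : Type*} [TopologicalSpace HM] (IM : ModelWithCorners ℝ VM HM)
  {VP : Type*} [NormedAddCommGroup VP] [NormedSpace ℝ VP]
  {HP : Type*} [TopologicalSpace HP] (IP : ModelWithCorners ℝ VP HP)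
  (G : Type*) [TopologicalSpace G] [ChartedSpace HG G] [Group G]
  (E : Type*) [TopologicalSpace E] [ChartedSpace HE E] [Group E]
  (M : Type*) [TopologicalSpace M] [ChartedSpace HM M]
  (P : Type*) [TopologicalSpace P] [ChartedSpace HP P]

/-- A smooth principal `G`-bundle structure on `P` over `M`: a smooth projection, a smooth right
action of `G`, and equivariant smooth local trivialisations `π⁻¹(U) ≃ U × G`. -/
structure SmoothPrincipalBundle where
  /-- the projection `π : P → M` -/
  proj : P → M
  /-- the right action `(u, g) ↦ u g` -/
  act : P → G → P
  act_one : ∀ u, act u 1 = u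
  act_mul : ∀ u g h, act u (g * h) = act (act u g) h
  proj_act : ∀ u g, proj (act u g) = proj u
  contMDiff_proj : ContMDiff IP IM ∞ proj
  contMDiff_act : ContMDiff (IP.prod IG) IP ∞ fun q : P × G => act q.1 q.2
  locally_trivial : ∀ x : M, ∃ (U : Set M) (e : OpenPartialHomeomorph P (M × G)),
    x ∈ U ∧ IsOpen U ∧ e.source = proj ⁻¹' U ∧ e.target = U ×ˢ Set.univ ∧
    ContMDiffOn IP (IM.prod IG) ∞ e e.source ∧ ContMDiffOn (IM.prod IG) IP ∞ e.symm e.target ∧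
    (∀ u ∈ e.source, (e u).1 = proj u) ∧
    ∀ u ∈ e.source, ∀ g : G, e (act u g) = ((e u).1, (e u).2 * g)

variable {IG IE IM IP G E M P}

namespace SmoothPrincipalBundle

variable (B : SmoothPrincipalBundle IG IM IP G M P)

/-- The linear map `A ↦ A^#_u` from the Lie algebra `𝔤 = T₁G` to `T_u P`, the derivative at `1` of
`g ↦ u g`. -/
def fundamental (u : P) : VG →L[ℝ] TangentSpace IP u :=
  (mfderiv IG IP (fun g : G => B.act u g) 1 : GroupLieAlgebra IG G →L[ℝ] _)

/-- The pullback `R_g^* a` of a form under the right translation `R_g : u ↦ u g`. -/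
def pullbackRight {F : Type*} [NormedAddCommGroup F] [NormedSpace ℝ F] {n : ℕ} (g : G)
    (a : DForm IP P F n) : DForm IP P F n := fun u =>
  (a (B.act u g)).compContinuousLinearMap (mfderiv IP IP (fun u => B.act u g) u)

/-- `θ` is a connection `1`-form: it is smooth, `R_g^* θ = g⁻¹ θ g`, and `θ(A^#) = A`. -/
structure IsConnection (θ : DForm IP P VG 1) : Prop where
  smooth : θ.IsSmooth
  equivariant : ∀ (g : G) (u : P), B.pullbackRight g θ u =
    (adjointAction IG g⁻¹).compContinuousAlternatingMap (θ u)
  fundamental : ∀ (u : P) (A : VG), θ u (fun _ => B.fundamental u A) = A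

/-- The horizontal projection `X ↦ X^H = X - θ(X)^#` on `T_u P`; see `horizontalPart_unique`. -/
def horizontalPart (θ : DForm IP P VG 1) (u : P) : TangentSpace IP u →L[ℝ] TangentSpace IP u :=
  ContinuousLinearMap.id ℝ (TangentSpace IP u) -
    (B.fundamental u).comp ((ContinuousAlternatingMap.ofSubsingleton ℝ _ _ (0 : Fin 1)).symm (θ u))

/-- The vertical space `ker dπ` consists of the values of the fundamental fields. -/
theorem mfderiv_proj_eq_zero_iff [LieGroup IG ∞ G] (u : P) (v : TangentSpace IP u) :
    mfderiv IP IM B.proj u v = 0 ↔ ∃ A : VG, B.fundamental u A = v := by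
  have hact : ContMDiff IG IP ∞ (fun g : G => B.act u g) :=
    B.contMDiff_act.comp (contMDiff_const.prodMk contMDiff_id)
  have hact1 : MDifferentiableAt IG IP (fun g : G => B.act u g) 1 :=
    (hact 1).mdifferentiableAt (by simp)
  have hproj : MDifferentiable IP IM B.proj := B.contMDiff_proj.mdifferentiable (by simp)
  constructor
  · intro hv
    obtain ⟨U, e, hxU, hU, hs, ht, he, he', hfst, heq⟩ := B.locally_trivial (B.proj u)
    have hus : u ∈ e.source := by rw [hs]; exact hxU
    set x := B.proj u with hx
    set g₀ := (e u).2 with hg₀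
    have hxg : (x, g₀) = e u := Prod.ext (hfst u hus).symm rfl
    have heu : MDifferentiableAt IP (IM.prod IG) e u :=
      (he.contMDiffAt (e.open_source.mem_nhds hus)).mdifferentiableAt (by simp)
    have hes : MDifferentiableAt (IM.prod IG) IP e.symm (x, g₀) := by
      rw [hxg]
      exact (he'.contMDiffAt (e.open_target.mem_nhds (e.map_source hus))).mdifferentiableAt
        (by simp)
    have hsnd : MDifferentiableAt IP IG (fun y => (e y).2) u := mdifferentiableAt_snd.comp u heu
    let w : TangentSpace IG g₀ := mfderiv IP IG (fun y => (e y).2) u v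
    let D : VM × VG →L[ℝ] VP := mfderiv (IM.prod IG) IP e.symm (x, g₀)
    let c : G → P := fun g => e.symm (x, g)
    have hl := (hasMFDerivAt_const (I := IG) (I' := IM) x g₀).prodMk (hasMFDerivAt_id (I := IG) g₀)
    have hc := HasMFDerivAt.comp g₀ hes.hasMFDerivAt hl
    have hk := (hproj u).hasMFDerivAt.prodMk hsnd.hasMFDerivAt
    have hek := HasMFDerivAt.comp u (g := e.symm) hes.hasMFDerivAt hk
    have hid : (e.symm ∘ fun y => (B.proj y, (e y).2)) =ᶠ[nhds u] id := by
      filter_upwards [e.open_source.mem_nhds hus] with y hy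
      have : (B.proj y, (e y).2) = e y := Prod.ext (hfst y hy).symm rfl
      simp only [Function.comp_apply, this, id, e.left_inv hy]
    have h₁ := hasMFDerivAt_unique (hek.congr_of_eventuallyEq hid.symm) (hasMFDerivAt_id u)
    have h₂ : D ((mfderiv IP IM B.proj u v : VM), (w : VG)) = v := DFunLike.congr_fun h₁ v
    have h₂' : D ((0 : VM), (w : VG)) = v := by
      rw [← h₂]; exact congrArg (fun z : VM => D (z, (w : VG))) hv.symm
    have hcu : c = fun g => B.act u (g₀⁻¹ * g) := by
      funext g
      have hsrc : B.act u (g₀⁻¹ * g) ∈ e.source := by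
        rw [hs, Set.mem_preimage, B.proj_act]; exact hxU
      have := heq u hus (g₀⁻¹ * g)
      rw [hfst u hus, ← hg₀, mul_inv_cancel_left] at this
      exact (congrArg e.symm this.symm).trans (e.left_inv hsrc)
    have hmul : MDifferentiableAt IG IG (fun g : G => g₀⁻¹ * g) g₀ :=
      (contMDiff_mul_left (I := IG) (n := ∞) (a := g₀⁻¹) g₀).mdifferentiableAt (by simp)
    have hact2 : MDifferentiableAt IG IP (fun g : G => B.act u g) (g₀⁻¹ * g₀) :=
      (hact _).mdifferentiableAt (by simp)
    have hr := HasMFDerivAt.comp g₀ hact2.hasMFDerivAt hmul.hasMFDerivAt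
    change HasMFDerivAt IG IP c g₀ _ at hc
    rw [hcu] at hc
    have h₃ := hasMFDerivAt_unique hr hc
    refine ⟨(mfderiv IG IG (fun g : G => g₀⁻¹ * g) g₀ w : VG), ?_⟩
    have h₄ := @congrArg G (VG →L[ℝ] VP) _ _ (fun g => mfderiv IG IP (fun g : G => B.act u g) g)
      (inv_mul_cancel g₀)
    have h₅ := DFunLike.congr_fun h₃ w
    have h₆ := DFunLike.congr_fun h₄ (mfderiv IG IG (fun g : G => g₀⁻¹ * g) g₀ w : VG)
    exact (h₆.symm.trans h₅).trans h₂'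
  · rintro ⟨A, rfl⟩
    have h₁ : HasMFDerivAt IG IM (fun g : G => B.proj (B.act u g)) 1
        ((mfderiv IP IM B.proj (B.act u 1)).comp (mfderiv IG IP (fun g : G => B.act u g) 1)) :=
      HasMFDerivAt.comp 1 (hproj _).hasMFDerivAt hact1.hasMFDerivAt
    have h₂ : (fun g : G => B.proj (B.act u g)) = fun _ => B.proj u :=
      funext fun g => B.proj_act u g
    rw [h₂] at h₁
    have h₃ := hasMFDerivAt_unique h₁ (hasMFDerivAt_const (B.proj u) (1 : G))
    have h₄ := @congrArg P (VP →L[ℝ] VM) _ _ (fun p => mfderiv IP IM B.proj p) (B.act_one u)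
    have h₅ := DFunLike.congr_fun h₃ A
    have h₆ := DFunLike.congr_fun h₄ (B.fundamental u A)
    exact h₆.symm.trans h₅

/-- `X^H` is the unique vector that is horizontal (`θ(X^H) = 0`) and differs from `X` by a vertical
vector (`dπ(X - X^H) = 0`). -/
theorem horizontalPart_unique [LieGroup IG ∞ G] {θ : DForm IP P VG 1} (hθ : B.IsConnection θ)
    (u : P) (v h : TangentSpace IP u) :
    h = B.horizontalPart θ u v ↔
      θ u (fun _ => h) = 0 ∧ mfderiv IP IM B.proj u (v - h) = 0 := by
  have key : ∀ x, B.horizontalPart θ u x = x - B.fundamental u (θ u fun _ => x) := by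
    intro x
    simp [horizontalPart]
  have lin : ∀ x y : TangentSpace IP u,
      θ u (fun _ => x - y) = θ u (fun _ => x) - θ u (fun _ => y) := by
    intro x y
    exact ((ContinuousAlternatingMap.ofSubsingleton ℝ _ _ (0 : Fin 1)).symm (θ u)).map_sub x y
  rw [B.mfderiv_proj_eq_zero_iff]
  constructor
  · rintro rfl
    rw [key]
    refine ⟨?_, θ u fun _ => v, by abel⟩
    rw [lin, hθ.fundamental, sub_self]
  · rintro ⟨h0, A, hA⟩
    rw [key]
    have hA' : A = θ u fun _ => v := by
      rw [← hθ.fundamental u A, hA, lin, h0, sub_zero]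
    rw [← hA', hA]
    abel

/-- The form `a ∘ (H × ⋯ × H)`. -/
def compHorizontal {F : Type*} [NormedAddCommGroup F] [NormedSpace ℝ F] {n : ℕ}
    (θ : DForm IP P VG 1) (a : DForm IP P F n) : DForm IP P F n := fun u =>
  (a u).compContinuousLinearMap (B.horizontalPart θ u)

/-- The exterior covariant derivative `D a = d a ∘ (H × ⋯ × H)`. -/
def covD {F : Type*} [NormedAddCommGroup F] [NormedSpace ℝ F] {n : ℕ}
    (θ : DForm IP P VG 1) (a : DForm IP P F n) : DForm IP P F (n + 1) :=
  B.compHorizontal θ a.d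

/-- The curvature `Ω = D θ`. -/
def curvature (θ : DForm IP P VG 1) : DForm IP P VG 2 := B.covD θ θ

/-- `(θ, m)` is a categorical connection on the bundle for the Lie crossed module `X`. -/
structure IsCategoricalConnection (X : LieCrossedModule IG IE G E)
    (θ : DForm IP P VG 1) (m : DForm IP P VE 2) : Prop where
  connection : B.IsConnection θ
  smooth : m.IsSmooth
  equivariant : ∀ (g : G) (u : P), B.pullbackRight g m u =
    (X.groupAct g⁻¹).compContinuousAlternatingMap (m u)
  horizontal : m = B.compHorizontal θ m
  bd_eq_curvature : ∀ u : P, X.dBd.compContinuousAlternatingMap (m u) = B.curvature θ u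

/-- The 2-curvature 3-form `𝓜 = dm ∘ (H × H × H)`. -/
def twoCurvature (θ : DForm IP P VG 1) (m : DForm IP P VE 2) : DForm IP P VE 3 := B.covD θ m

end SmoothPrincipalBundle

/-- The product `a ∧^▷ b` of a `𝔤`-valued and an `𝔢`-valued form. -/
def LieCrossedModule.wedge (X : LieCrossedModule IG IE G E) {n m : ℕ}
    (a : DForm IP P VG n) (b : DForm IP P VE m) : DForm IP P VE (n + m) := fun u =>
  wedgeAlong X.derivedAct (a u) (b u)

end Bundles

end

/-!
The covariant derivative of a horizontal equivariant `𝔢`-valued form `a` obeys the structure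
equation `Da = da + θ ∧^▷ a` (`IsConnection.d_apply_of_horizontal`). It is proved without flows or
Lie derivatives: horizontality and equivariance say exactly that the pullback of `a` under the
action map `(u, g) ↦ u g` is `(g⁻¹ ▷ ·) pr₁^* a`, and the exterior derivative of this identity, taken
at `g = 1` and evaluated on the pairs `(vᵢ^H, θ(vᵢ))`, is the structure equation.

Applied to `a = m` it gives `𝓜 = dm + θ ∧^▷ m`, so `𝓜` is smooth, and `d𝓜 = d(θ ∧^▷ m)`. On
horizontal vectors `θ` vanishes and only `dθ ∧^▷ m = Ω ∧^▷ m = ∂(m) ∧^▷ m` survives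
(`extDeriv_wedgeOne_eq_zero`). The six terms of this product cancel in pairs because the Peiffer
lifting `(a, b) ↦ ∂(a) ▷ b` on `𝔢` is antisymmetric (`LieCrossedModule.derivedAct_dBd_antisymm`): by
the Peiffer identity `∂(e) ▷ f = e f e⁻¹` it is the derivative at `1` of the adjoint action of `E`,
i.e. the Lie bracket. Antisymmetry of that derivative is obtained directly from the symmetry of the
second derivative of the multiplication in a chart (`fderiv_conjugation_antisymm`). Hence `D𝓜 = 0`.

Finally `𝓜` is itself horizontal and equivariant (`IsConnection.covD_equivariant`), so the structure
equation for `a = 𝓜` turns `D𝓜 = 0` into `d𝓜 + θ ∧^▷ 𝓜 = 0`.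

The tangent spaces of a manifold are by definition copies of the model space. Derivatives and
tangent vectors are therefore treated as maps between, and elements of, the model spaces, and chart
expressions are taken in the preferred charts `extChartAt`.
-/

noncomputable section

/-! ### Alternating maps: wedge product with a one-form -/

section Alternating

variable {V : Type*} [NormedAddCommGroup V] [NormedSpace ℝ V]
  {W : Type*} [NormedAddCommGroup W] [NormedSpace ℝ W]
  {F₁ F₂ F₃ : Type*} [NormedAddCommGroup F₁] [NormedSpace ℝ F₁]
  [NormedAddCommGroup F₂] [NormedSpace ℝ F₂] [NormedAddCommGroup F₃] [NormedSpace ℝ F₃]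
  {n m : ℕ}

/-- Composition `(g, f) ↦ g ∘ f` of a continuous linear map with a continuous alternating map, as a
continuous bilinear map. -/
def altPostcomp (V F₁ F₂ : Type*) [NormedAddCommGroup V] [NormedSpace ℝ V]
    [NormedAddCommGroup F₁] [NormedSpace ℝ F₁] [NormedAddCommGroup F₂] [NormedSpace ℝ F₂] (n : ℕ) :
    (F₁ →L[ℝ] F₂) →L[ℝ] (V [⋀^Fin n]→L[ℝ] F₁) →L[ℝ] (V [⋀^Fin n]→L[ℝ] F₂) :=
  LinearMap.mkContinuous₂
    (LinearMap.mk₂ ℝ (fun g f => g.compContinuousAlternatingMap f)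
      (fun _ _ _ => by ext; simp) (fun _ _ _ => by ext; simp) (fun _ _ _ => by ext; simp)
      (fun _ _ _ => by ext; simp)) 1
    (fun g f => by
      rw [one_mul]
      exact ContinuousLinearMap.norm_compContinuousAlternatingMap_le g f)

@[simp]
theorem altPostcomp_apply (g : F₁ →L[ℝ] F₂) (f : V [⋀^Fin n]→L[ℝ] F₁) :
    altPostcomp V F₁ F₂ n g f = g.compContinuousAlternatingMap f := rfl

/-- The wedge product `a ∧ b` along `β` of a linear form `a` and an alternating map `b`, given by
`(a ∧ b)(v₀,…,vₙ) = ∑ᵢ (-1)ⁱ β (a vᵢ) (b (v₀,…,v̂ᵢ,…,vₙ))`, as a continuous bilinear map. -/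
def wedgeOne (β : F₁ →L[ℝ] F₂ →L[ℝ] F₃) :
    (V →L[ℝ] F₁) →L[ℝ] (V [⋀^Fin n]→L[ℝ] F₂) →L[ℝ] (V [⋀^Fin (n + 1)]→L[ℝ] F₃) :=
  LinearMap.mkContinuous₂
    (LinearMap.mk₂ ℝ
      (fun a b => .alternatizeUncurryFin (((altPostcomp V F₂ F₃ n).flip b).comp (β.comp a)))
      (fun _ _ _ => by ext; simp [ContinuousAlternatingMap.alternatizeUncurryFin_apply])
      (fun _ _ _ => by
        ext
        simp [ContinuousAlternatingMap.alternatizeUncurryFin_apply, Finset.smul_sum,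
          smul_comm (_ : ℝ) (_ : ℤ)])
      (fun _ _ _ => by ext; simp [ContinuousAlternatingMap.alternatizeUncurryFin_apply])
      (fun _ _ _ => by
        ext
        simp [ContinuousAlternatingMap.alternatizeUncurryFin_apply, Finset.smul_sum,
          smul_comm (_ : ℝ) (_ : ℤ)]))
    ((n + 1) * ‖β‖) fun a b => by
      refine (ContinuousAlternatingMap.norm_alternatizeUncurryFin_le _).trans ?_
      rw [mul_assoc, mul_assoc]
      gcongr
      refine ContinuousLinearMap.opNorm_le_bound _ (by positivity) fun v => ?_
      refine (ContinuousLinearMap.norm_compContinuousAlternatingMap_le _ _).trans ?_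
      calc ‖β (a v)‖ * ‖b‖ ≤ (‖β‖ * (‖a‖ * ‖v‖)) * ‖b‖ := by
            gcongr
            exact (β.le_opNorm _).trans (by gcongr; exact a.le_opNorm v)
        _ = ‖β‖ * (‖a‖ * ‖b‖) * ‖v‖ := by ring

theorem wedgeOne_apply (β : F₁ →L[ℝ] F₂ →L[ℝ] F₃) (a : V →L[ℝ] F₁) (b : V [⋀^Fin n]→L[ℝ] F₂)
    (v : Fin (n + 1) → V) :
    wedgeOne β a b v = ∑ i : Fin (n + 1), (-1 : ℤ) ^ (i : ℕ) • β (a (v i)) (b (i.removeNth v)) := by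
  change ContinuousAlternatingMap.alternatizeUncurryFin
    (((altPostcomp V F₂ F₃ n).flip b).comp (β.comp a)) v = _
  simp [ContinuousAlternatingMap.alternatizeUncurryFin_apply]

theorem ContDiffOn.wedgeOne {β : F₁ →L[ℝ] F₂ →L[ℝ] F₃} {s : Set W} {a : W → V →L[ℝ] F₁}
    {b : W → V [⋀^Fin n]→L[ℝ] F₂} {k : WithTop ℕ∞} (ha : ContDiffOn ℝ k a s)
    (hb : ContDiffOn ℝ k b s) : ContDiffOn ℝ k (fun x => wedgeOne β (a x) (b x)) s := by
  fun_prop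

open Equiv in
/-- The sum over all permutations in the definition of `wedgeAlong` collapses when the first factor
has degree one: the permutations fixing the argument of `a` contribute equally, and the others are
obtained from them by cycles. -/
theorem wedgeAlong_one_apply {T : Type*} [AddCommGroup T] [Module ℝ T] [TopologicalSpace T]
    (β : F₁ →L[ℝ] F₂ →L[ℝ] F₃) (a : T [⋀^Fin 1]→L[ℝ] F₁) (b : T [⋀^Fin m]→L[ℝ] F₂)
    (v : Fin (m + 1) → T) :
    wedgeAlong β a b (fun i => v (Fin.cast (add_comm 1 m) i)) =
      ∑ i : Fin (m + 1), (-1 : ℤ) ^ (i : ℕ) • β (a fun _ => v i) (b (i.removeNth v)) := by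
  have h1 : ContinuousMultilinearMap.alternatization (tensorAlong β a b)
      (fun i => v (Fin.cast (add_comm 1 m) i)) =
      ∑ σ : Perm (Fin (m + 1)), (Perm.sign σ : ℤ) •
        β (a fun _ => v (σ 0)) (b fun j => v (σ j.succ)) := by
    rw [ContinuousMultilinearMap.alternatization_apply_apply]
    refine Fintype.sum_equiv ((finCongr (add_comm 1 m)).permCongr) _ _ fun σ => ?_
    rw [Perm.sign_permCongr, Units.smul_def]
    congr 1
    change β (a _) (b _) = _
    congr 2
    · congr 1
      ext i
      fin_cases i
      simp only [Function.comp, permCongr_apply]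
      congr 1
    · ext j
      simp only [Function.comp, permCongr_apply]
      congr 3
      ext
      simp [add_comm]
  have h2 : ∀ (p : Fin (m + 1)) (e : Perm (Fin m)),
      (Perm.sign (Perm.decomposeFin.symm (p, e)) : ℤ) •
        β (a fun _ => v (Perm.decomposeFin.symm (p, e) 0))
          (b fun j => v (Perm.decomposeFin.symm (p, e) j.succ)) =
      (-1 : ℤ) ^ (p : ℕ) • β (a fun _ => v p) (b (p.removeNth v)) := by
    intro p e
    have hb : b (fun j => v (Perm.decomposeFin.symm (p, e) j.succ)) =
        (Perm.sign e : ℤ) • b (fun j => v (swap 0 p j.succ)) := by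
      simp only [Perm.decomposeFin_symm_apply_succ]
      rw [← Units.smul_def]
      exact b.toAlternatingMap.map_perm (fun j => v (swap 0 p j.succ)) e
    rw [hb, Perm.decomposeFin.symm_sign, Perm.decomposeFin_symm_apply_zero, map_zsmul, smul_smul]
    have hs : (Perm.sign e : ℤ) * (Perm.sign e : ℤ) = 1 := Int.units_coe_mul_self _
    rw [Units.val_mul, mul_assoc, hs, mul_one]
    refine Fin.cases ?_ (fun k => ?_) p
    · simp only [swap_self]
      simp [Fin.tail_def]
    · have hc : b (fun j => v (swap 0 k.succ j.succ)) =
          (Perm.sign k.cycleRange : ℤ) • b (k.succ.removeNth v) := by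
        rw [← Units.smul_def]
        refine Eq.trans ?_ (b.toAlternatingMap.map_perm (k.succ.removeNth v) k.cycleRange)
        refine congrArg b (funext fun j => ?_)
        simp only [Function.comp, Fin.removeNth_apply, Fin.succAbove_cycleRange]
      rw [hc, Fin.sign_cycleRange, map_zsmul, smul_smul]
      simp [pow_succ]
  have h3 : ∑ σ : Perm (Fin (m + 1)), (Perm.sign σ : ℤ) •
        β (a fun _ => v (σ 0)) (b fun j => v (σ j.succ)) =
      (m ! : ℝ) • ∑ i : Fin (m + 1), (-1 : ℤ) ^ (i : ℕ) • β (a fun _ => v i) (b (i.removeNth v)) := by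
    rw [← Perm.decomposeFin.symm.sum_comp, Fintype.sum_prod_type, Finset.smul_sum]
    refine Finset.sum_congr rfl fun p _ => ?_
    simp only [h2, Finset.sum_const, Finset.card_univ, Fintype.card_perm, Fintype.card_fin]
    rw [Nat.cast_smul_eq_nsmul]
  have h4 : wedgeAlong β a b (fun i => v (Fin.cast (add_comm 1 m) i)) =
      (((1 + m)! : ℝ) / ((1 ! : ℝ) * (m ! : ℝ))) • ((((1 + m)! : ℝ)⁻¹) •
        ContinuousMultilinearMap.alternatization (tensorAlong β a b)
          (fun i => v (Fin.cast (add_comm 1 m) i))) := rfl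
  have hm : (m ! : ℝ) ≠ 0 := by positivity
  have hm' : ((1 + m)! : ℝ) ≠ 0 := by positivity
  rw [h4, h1, h3, smul_smul, smul_smul]
  have : ((1 + m)! : ℝ) / ((1 ! : ℝ) * (m ! : ℝ)) * ((1 + m)! : ℝ)⁻¹ * (m ! : ℝ) = 1 := by
    simp only [Nat.factorial_one, Nat.cast_one, one_mul]
    field_simp
  rw [this, one_smul]

/-- The case `m = 3`, in which the cast from `Fin (1 + 3)` to `Fin (3 + 1)` is the identity. -/
theorem wedgeAlong_one_three_apply {T : Type*} [AddCommGroup T] [Module ℝ T] [TopologicalSpace T]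
    (β : F₁ →L[ℝ] F₂ →L[ℝ] F₃) (a : T [⋀^Fin 1]→L[ℝ] F₁) (b : T [⋀^Fin 3]→L[ℝ] F₂)
    (v : Fin 4 → T) :
    wedgeAlong β a b v =
      ∑ i : Fin 4, (-1 : ℤ) ^ (i : ℕ) • β (a fun _ => v i) (b (i.removeNth v)) :=
  wedgeAlong_one_apply β a b v

end Alternating

/-! ### Exterior derivatives on a vector space -/

section ExtDeriv

variable {V : Type*} [NormedAddCommGroup V] [NormedSpace ℝ V]
  {W : Type*} [NormedAddCommGroup W] [NormedSpace ℝ W]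
  {F F₁ F₂ F₃ : Type*} [NormedAddCommGroup F] [NormedSpace ℝ F]
  [NormedAddCommGroup F₁] [NormedSpace ℝ F₁]
  [NormedAddCommGroup F₂] [NormedSpace ℝ F₂] [NormedAddCommGroup F₃] [NormedSpace ℝ F₃]
  {n : ℕ}

theorem ContDiffOn.extDeriv {α : V → V [⋀^Fin n]→L[ℝ] F} {s : Set V} (hα : ContDiffOn ℝ ∞ α s)
    (hs : IsOpen s) : ContDiffOn ℝ ∞ (extDeriv α) s :=
  (ContinuousAlternatingMap.alternatizeUncurryFinCLM ℝ V F).contDiff.comp_contDiffOn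
    (hα.fderiv_of_isOpen hs (by simp))

theorem extDeriv_postcomp (κ : F₁ →L[ℝ] F₂) {α : V → V [⋀^Fin n]→L[ℝ] F₁} {x : V}
    (hα : DifferentiableAt ℝ α x) (v : Fin (n + 1) → V) :
    _root_.extDeriv (fun y => κ.compContinuousAlternatingMap (α y)) x v =
      κ (_root_.extDeriv α x v) := by
  have h1 : HasFDerivAt (fun y => κ.compContinuousAlternatingMap (α y))
      ((altPostcomp V F₁ F₂ n κ).comp (fderiv ℝ α x)) x :=
    (altPostcomp V F₁ F₂ n κ).hasFDerivAt.comp x hα.hasFDerivAt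
  rw [_root_.extDeriv, _root_.extDeriv, h1.fderiv]
  simp [ContinuousAlternatingMap.alternatizeUncurryFin_apply]

/-- The exterior derivative of `κ · pr₁^* α` on a product, where `κ` is an operator-valued function
of the second variable. -/
theorem extDeriv_smul_fst {κ : W → F →L[ℝ] F} {κ' : W →L[ℝ] F →L[ℝ] F}
    {α : V → V [⋀^Fin n]→L[ℝ] F} {x : V} {y : W} (hκ : HasFDerivAt κ κ' y)
    (hκy : κ y = ContinuousLinearMap.id ℝ F) (hα : DifferentiableAt ℝ α x)
    (w : Fin (n + 1) → V × W) :
    _root_.extDeriv (fun z : V × W => (κ z.2).compContinuousAlternatingMap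
        ((α z.1).compContinuousLinearMap (ContinuousLinearMap.fst ℝ V W))) (x, y) w =
      _root_.extDeriv α x (fun i => (w i).1) +
        ∑ i : Fin (n + 1), (-1 : ℤ) ^ (i : ℕ) • κ' (w i).2 (α x (i.removeNth fun j => (w j).1)) := by
  have h1 : HasFDerivAt (fun z : V × W => κ z.2) (κ'.comp (.snd ℝ V W)) (x, y) :=
    HasFDerivAt.comp (x, y) (g := κ) hκ hasFDerivAt_snd
  let c : (V [⋀^Fin n]→L[ℝ] F) →L[ℝ] (V × W) [⋀^Fin n]→L[ℝ] F :=
    ContinuousAlternatingMap.compContinuousLinearMapCLM (ContinuousLinearMap.fst ℝ V W)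
  have h2 : HasFDerivAt (fun z : V × W => c (α z.1)) (c.comp ((fderiv ℝ α x).comp (.fst ℝ V W)))
      (x, y) :=
    c.hasFDerivAt.comp (x, y) (HasFDerivAt.comp (x, y) (g := α) hα.hasFDerivAt hasFDerivAt_fst)
  have h3 := (altPostcomp (V × W) F F n).hasFDerivAt_of_bilinear h1 h2
  have h4 := h3.fderiv
  change _root_.extDeriv (fun z : V × W => altPostcomp (V × W) F F n (κ z.2) (c (α z.1)))
    (x, y) w = _
  rw [_root_.extDeriv, _root_.extDeriv, h4]
  simp only [ContinuousAlternatingMap.alternatizeUncurryFin_apply]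
  rw [← Finset.sum_add_distrib]
  refine Finset.sum_congr rfl fun i _ => ?_
  rw [← smul_add]
  congr 1
  simp [hκy, c]
  rfl

/-- At vectors annihilated by `a`, the exterior derivative of `a ∧ b` is the sum of the terms
`β (da(vᵢ, vⱼ)) (b (…))`. If on these vectors `da` is the image of `b` under a Peiffer lifting,
i.e. a linear map `D` for which `(c, c') ↦ β (D c) c'` is antisymmetric, the terms cancel in
pairs. -/
theorem extDeriv_wedgeOne_eq_zero {β : F₁ →L[ℝ] F₂ →L[ℝ] F₂} {D : F₂ →L[ℝ] F₁}
    (hD : ∀ c c', β (D c) c' = -β (D c') c) {a : V → V →L[ℝ] F₁} {b : V → V [⋀^Fin 2]→L[ℝ] F₂}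
    {x : V} (ha : DifferentiableAt ℝ a x) (hb : DifferentiableAt ℝ b x) (v : Fin 4 → V)
    (hv : ∀ i, a x (v i) = 0)
    (hda : ∀ i j, fderiv ℝ a x (v i) (v j) - fderiv ℝ a x (v j) (v i) = D (b x ![v i, v j])) :
    _root_.extDeriv (fun y => wedgeOne β (a y) (b y)) x v = 0 := by
  have h1 := (wedgeOne (V := V) (n := 2) β).hasFDerivAt_of_bilinear ha.hasFDerivAt hb.hasFDerivAt
  -- Since `a x` kills the vectors, only the terms with the derivative of `a` contribute.
  let f : V →L[ℝ] V →L[ℝ] V [⋀^Fin 2]→L[ℝ] F₂ :=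
    (ContinuousLinearMap.compL ℝ V F₁ _ (((altPostcomp V F₂ F₂ 2).flip (b x)).comp β)).comp
      (fderiv ℝ a x)
  have h3 : _root_.extDeriv (fun y => wedgeOne β (a y) (b y)) x v =
      ContinuousAlternatingMap.alternatizeUncurryFin
        ((ContinuousAlternatingMap.alternatizeUncurryFinCLM ℝ V F₂).comp f) v := by
    rw [_root_.extDeriv, h1.fderiv, ContinuousAlternatingMap.alternatizeUncurryFin_apply,
      ContinuousAlternatingMap.alternatizeUncurryFin_apply]
    refine Finset.sum_congr rfl fun i _ => ?_
    congr 1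
    simp [f, wedgeOne_apply, ContinuousAlternatingMap.alternatizeUncurryFin_apply, Fin.removeNth,
      hv]
  rw [h3, ContinuousAlternatingMap.alternatizeUncurryFin_alternatizeUncurryFinCLM_comp_apply]
  have hf : ∀ i j, f (v i) (v j) - f (v j) (v i) =
      (β (D (b x ![v i, v j]))).compContinuousAlternatingMap (b x) := by
    intro i j
    rw [← hda]
    ext; simp [f]
  have hf' : ∀ i j w, f (v i) (v j) w - f (v j) (v i) w = β (D (b x ![v i, v j])) (b x w) := by
    intro i j w
    have := DFunLike.congr_fun (hf i j) w
    simpa using this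
  -- `t i j` is the term of the alternatised sum in which `da` takes the arguments `i` and `j + 1`.
  let c : Fin 4 → Fin 4 → F₂ := fun p q => b x ![v p, v q]
  let t : Fin 3 → Fin 3 → F₂ := fun i j => (-1 : ℤ) ^ (i + j : ℕ) •
    β (D (c i.castSucc j.succ))
      (c (i.castSucc.succAbove (j.succAbove 0)) (i.castSucc.succAbove (j.succAbove 1)))
  have ht : ∀ i j : Fin 3, (-1 : ℤ) ^ (i + j : ℕ) •
      (f (v i.castSucc) (v j.succ) (j.removeNth <| i.castSucc.removeNth v) -
        f (v j.succ) (v i.castSucc) (j.removeNth <| i.castSucc.removeNth v)) = t i j := by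
    intro i j
    rw [hf']
    congr 3
    ext k
    fin_cases k <;> rfl
  have hsum : ∀ (i : Fin 3) (q : Fin 3 → F₂), ∑ j ≥ i, q j = ∑ j, if i ≤ j then q j else 0 := by
    intro i q
    rw [← Finset.sum_filter]
    congr 1
    ext
    simp
  have h00 : t 0 0 = β (D (c 0 1)) (c 2 3) := one_smul _ _
  have h01 : t 0 1 = -β (D (c 0 2)) (c 1 3) := neg_one_smul _ _
  have h02 : t 0 2 = β (D (c 0 3)) (c 1 2) := one_smul _ _
  have h11 : t 1 1 = β (D (c 1 2)) (c 0 3) := one_smul _ _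
  have h12 : t 1 2 = -β (D (c 1 3)) (c 0 2) := neg_one_smul _ _
  have h22 : t 2 2 = β (D (c 2 3)) (c 0 1) := one_smul _ _
  simp only [ht, hsum, Fin.sum_univ_three]
  refine (Fin.sum_univ_three _).trans ?_
  rw [if_pos (by decide), if_pos (by decide), if_pos (by decide), if_neg (by decide),
    if_pos (by decide), if_pos (by decide), if_neg (by decide), if_neg (by decide),
    if_pos (by decide)]
  simp only [h00, h01, h02, h11, h12, h22, hD (c 0 1), hD (c 0 2), hD (c 0 3)]
  abel

end ExtDeriv

/-! ### Antisymmetry of the second derivative of conjugation -/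

section Commutator

open Filter Topology

variable {V : Type*} [NormedAddCommGroup V] [NormedSpace ℝ V]

/-- Let `μ` be a multiplication with neutral element `o` on a neighbourhood of `o` in a vector
space, and `c` the conjugation `c(x, y) = x y x⁻¹`, characterised by `x y = (x y x⁻¹) x`. The mixed
second derivative of `c` at `(o, o)` is the commutator
`D₁D₂μ(a, b) - D₁D₂μ(b, a)`, and hence antisymmetric. -/
theorem fderiv_conjugation_antisymm {μ c : V × V → V} {o : V} (hμ : ContDiffAt ℝ ∞ μ (o, o))
    (hc : ContDiffAt ℝ ∞ c (o, o)) (hco : ∀ᶠ x in 𝓝 o, c (x, o) = o)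
    (hoc : ∀ᶠ y in 𝓝 o, c (o, y) = y) (hμo : ∀ᶠ x in 𝓝 o, μ (x, o) = x)
    (hμc : ∀ᶠ z in 𝓝 (o, o), μ z = μ (c z, z.1)) (a b : V) :
    fderiv ℝ (fun x => (fderiv ℝ c (x, o)).comp (.inr ℝ V V)) o a b =
      -fderiv ℝ (fun x => (fderiv ℝ c (x, o)).comp (.inr ℝ V V)) o b a := by
  set K : V → V →L[ℝ] V := fun x => (fderiv ℝ c (x, o)).comp (.inr ℝ V V) with hK
  let L : V → V →L[ℝ] V := fun x => (fderiv ℝ μ (x, o)).comp (.inr ℝ V V)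
  let R : V → V →L[ℝ] V := fun x => (fderiv ℝ μ (o, x)).comp (.inl ℝ V V)
  have hil : Tendsto (fun x : V => (x, o)) (𝓝 o) (𝓝 (o, o)) :=
    (Continuous.prodMk continuous_id continuous_const).tendsto o
  have hir : Tendsto (fun x : V => (o, x)) (𝓝 o) (𝓝 (o, o)) :=
    (Continuous.prodMk continuous_const continuous_id).tendsto o
  have hμd : ∀ᶠ z in 𝓝 (o, o), DifferentiableAt ℝ μ z :=
    ((hμ.of_le (m := 1) (by simp)).eventually (by simp)).mono
      fun z hz => hz.differentiableAt (by simp)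
  have hcd : ∀ᶠ z in 𝓝 (o, o), DifferentiableAt ℝ c z :=
    ((hc.of_le (m := 1) (by simp)).eventually (by simp)).mono
      fun z hz => hz.differentiableAt (by simp)
  -- The derivative of `x y = (x y x⁻¹) x` with respect to `y` at `y = o`.
  have hLRK : L =ᶠ[𝓝 o] fun x => (R x).comp (K x) := by
    filter_upwards [hir.eventually hμd, hil.eventually hcd,
      hil.eventually (eventually_eventually_nhds.2 hμc), hco] with x h1 h2 h3 h4
    have h5 : HasFDerivAt (fun z : V × V => (c z, z.1))
        ((fderiv ℝ c (x, o)).prod (.fst ℝ V V)) (x, o) := h2.hasFDerivAt.prodMk hasFDerivAt_fst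
    have h6 : HasFDerivAt μ (fderiv ℝ μ (o, x)) (c (x, o), (x, o).1) := by
      rw [h4]; exact h1.hasFDerivAt
    have h7 := (HasFDerivAt.comp (x, o) h6 h5).congr_of_eventuallyEq h3
    ext w
    simp [L, R, K, h7.fderiv, ContinuousLinearMap.prod_apply]
  have hμ2 : DifferentiableAt ℝ (fderiv ℝ μ) (o, o) :=
    (hμ.fderiv_right (m := ∞) (by simp)).differentiableAt (by simp)
  have hc2 : DifferentiableAt ℝ (fderiv ℝ c) (o, o) :=
    (hc.fderiv_right (m := ∞) (by simp)).differentiableAt (by simp)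
  have dil : HasFDerivAt (fun x : V => (x, o)) (.inl ℝ V V) o := hasFDerivAt_prodMk_left o o
  have dir : HasFDerivAt (fun x : V => (o, x)) (.inr ℝ V V) o := hasFDerivAt_prodMk_right o o
  have dL := (HasFDerivAt.comp o (g := fderiv ℝ μ) (f := fun x => (x, o)) hμ2.hasFDerivAt
    dil).clm_comp (hasFDerivAt_const (ContinuousLinearMap.inr ℝ V V) o)
  have dR := (HasFDerivAt.comp o (g := fderiv ℝ μ) (f := fun x => (o, x)) hμ2.hasFDerivAt
    dir).clm_comp (hasFDerivAt_const (ContinuousLinearMap.inl ℝ V V) o)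
  have dK : DifferentiableAt ℝ K o := ((HasFDerivAt.comp o (g := fderiv ℝ c)
    (f := fun x => (x, o)) hc2.hasFDerivAt dil).clm_comp
      (hasFDerivAt_const (ContinuousLinearMap.inr ℝ V V) o)).differentiableAt
  have hKo : K o = ContinuousLinearMap.id ℝ V := by
    have h := (HasFDerivAt.comp o (g := c) (f := fun y => (o, y))
      hcd.self_of_nhds.hasFDerivAt dir).congr_of_eventuallyEq (hoc.mono fun y hy => hy.symm)
    exact h.unique (hasFDerivAt_id o)
  have hRo : R o = ContinuousLinearMap.id ℝ V := by
    have h := (HasFDerivAt.comp o (g := μ) (f := fun x => (x, o))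
      hμd.self_of_nhds.hasFDerivAt dil).congr_of_eventuallyEq (hμo.mono fun y hy => hy.symm)
    exact h.unique (hasFDerivAt_id o)
  have dRK := HasFDerivAt.clm_comp (c := R) dR dK.hasFDerivAt
  -- Differentiating `L = R ∘ K` at `o`, where `R` and `K` are the identity, gives `L' = R' + K'`.
  have h1 := (HasFDerivAt.congr_of_eventuallyEq dRK hLRK).unique dL
  have hsymm := hμ.isSymmSndFDerivAt (by
    rw [minSmoothness_of_isRCLikeNormedField]
    exact WithTop.coe_le_coe.2 le_top)
  have key : ∀ u w, fderiv ℝ K o u w = fderiv ℝ (fderiv ℝ μ) (o, o) (u, 0) (0, w) -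
      fderiv ℝ (fderiv ℝ μ) (o, o) (w, 0) (0, u) := by
    intro u w
    have h2 := DFunLike.congr_fun (DFunLike.congr_fun h1 u) w
    rw [hsymm (w, 0) (0, u)]
    simp [hKo, hRo] at h2
    rw [← h2]
    abel
  rw [key, key, neg_sub]

end Commutator

/-! ### Derivatives of families of maps at a common fixed point -/

section FixedPoint

open Filter Topology

variable {VN : Type*} [NormedAddCommGroup VN] [NormedSpace ℝ VN]
  {HN : Type*} [TopologicalSpace HN] {IN : ModelWithCorners ℝ VN HN} [IN.Boundaryless]
  {N : Type*} [TopologicalSpace N] [ChartedSpace HN N]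
  {VE : Type*} [NormedAddCommGroup VE] [NormedSpace ℝ VE]
  {HE : Type*} [TopologicalSpace HE] {IE : ModelWithCorners ℝ VE HE}
  {E : Type*} [TopologicalSpace E] [ChartedSpace HE E]

/-- The manifold derivative at `x` is the derivative of the expression in the preferred charts at
`x` and at its image. -/
theorem HasMFDerivAt.hasFDerivAt_chart {f : N → E} {x : N} {y : E} {D : VN →L[ℝ] VE}
    (hf : HasMFDerivAt IN IE f x D) (hxy : f x = y) :
    HasFDerivAt (fun v => extChartAt IE y (f ((extChartAt IN x).symm v))) D
      (extChartAt IN x x) := by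
  subst hxy
  have h : HasFDerivWithinAt (writtenInExtChartAt IN IE x f) D (Set.range IN)
    (extChartAt IN x x) := hf.2
  rw [IN.range_eq_univ, hasFDerivWithinAt_univ] at h
  exact h

theorem contMDiffAt_extChartAt_symm [IsManifold IN ∞ N] (x : N) {y : VN}
    (hy : y ∈ (extChartAt IN x).target) :
    ContMDiffAt 𝓘(ℝ, VN) IN ∞ (extChartAt IN x).symm y :=
  (contMDiffOn_extChartAt_symm x).contMDiffAt ((isOpen_extChartAt_target x).mem_nhds hy)

variable (IN IE) in
/-- The expression in the preferred charts at `x₀` and `e₀` of a family `F` of self-maps of `E`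
parametrised by `N`. -/
def chartFamily (F : N × E → E) (x₀ : N) (e₀ : E) : VN × VE → VE := fun z =>
  extChartAt IE e₀ (F ((extChartAt IN x₀).symm z.1, (extChartAt IE e₀).symm z.2))

variable [IE.Boundaryless] [IsManifold IN ∞ N] [IsManifold IE ∞ E] {F : N × E → E} {x₀ : N} {e₀ : E}

theorem contDiffAt_chartFamily (hF : ContMDiff (IN.prod IE) IE ∞ F) (h₀ : F (x₀, e₀) = e₀) :
    ContDiffAt ℝ ∞ (chartFamily IN IE F x₀ e₀) (extChartAt IN x₀ x₀, extChartAt IE e₀ e₀) := by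
  rw [← contMDiffAt_iff_contDiffAt]
  have h1 : ContMDiffAt 𝓘(ℝ, VN × VE) IN ∞ (fun z : VN × VE => (extChartAt IN x₀).symm z.1)
      (extChartAt IN x₀ x₀, extChartAt IE e₀ e₀) :=
    ContMDiffAt.comp (g := (extChartAt IN x₀).symm) (I' := 𝓘(ℝ, VN)) _
      (contMDiffAt_extChartAt_symm x₀ (mem_extChartAt_target x₀))
      contDiff_fst.contMDiff.contMDiffAt
  have h2 : ContMDiffAt 𝓘(ℝ, VN × VE) IE ∞ (fun z : VN × VE => (extChartAt IE e₀).symm z.2)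
      (extChartAt IN x₀ x₀, extChartAt IE e₀ e₀) :=
    ContMDiffAt.comp (g := (extChartAt IE e₀).symm) (I' := 𝓘(ℝ, VE)) _
      (contMDiffAt_extChartAt_symm e₀ (mem_extChartAt_target e₀))
      contDiff_snd.contMDiff.contMDiffAt
  refine ContMDiffAt.comp (g := extChartAt IE e₀) (I' := IE) _ ?_
    (ContMDiffAt.comp (I' := IN.prod IE) _ (hF _) (h1.prodMk h2))
  simp only [extChartAt_to_inv, h₀]
  exact contMDiffAt_extChartAt

/-- If `e₀` is fixed by a smooth family of self-maps of `E`, the derivative at `e₀` is, in charts,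
the partial derivative of the family. -/
theorem eventually_mfderiv_eq_chartFamily (hF : ContMDiff (IN.prod IE) IE ∞ F)
    (h₀ : ∀ x, F (x, e₀) = e₀) : ∀ᶠ x in 𝓝 (extChartAt IN x₀ x₀),
      (mfderiv IE IE (fun e => F ((extChartAt IN x₀).symm x, e)) e₀ : VE →L[ℝ] VE) =
        (fderiv ℝ (chartFamily IN IE F x₀ e₀) (x, extChartAt IE e₀ e₀)).comp (.inr ℝ VN VE) := by
  have hd : ∀ᶠ z in 𝓝 (extChartAt IN x₀ x₀, extChartAt IE e₀ e₀),
      DifferentiableAt ℝ (chartFamily IN IE F x₀ e₀) z :=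
    (((contDiffAt_chartFamily hF (h₀ x₀)).of_le (m := 1) (by simp)).eventually (by simp)).mono
      fun z hz => hz.differentiableAt (by simp)
  have hil : Tendsto (fun x : VN => (x, extChartAt IE e₀ e₀)) (𝓝 (extChartAt IN x₀ x₀))
      (𝓝 (extChartAt IN x₀ x₀, extChartAt IE e₀ e₀)) :=
    (Continuous.prodMk continuous_id continuous_const).tendsto _
  filter_upwards [hil.eventually hd] with x hx
  have hf : MDifferentiableAt IE IE (fun e => F ((extChartAt IN x₀).symm x, e)) e₀ :=
    (hF.comp (contMDiff_const.prodMk contMDiff_id)).mdifferentiable (by simp) _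
  let D : VE →L[ℝ] VE := mfderiv IE IE (fun e => F ((extChartAt IN x₀).symm x, e)) e₀
  have h1 := HasMFDerivAt.hasFDerivAt_chart (D := D) hf.hasMFDerivAt (h₀ _)
  exact h1.unique (HasFDerivAt.comp _ hx.hasFDerivAt (hasFDerivAt_prodMk_right _ _))

/-- The derivative at a common fixed point of a smooth family of self-maps depends differentiably on
the parameter. -/
theorem differentiableAt_mfderiv_fixed (hF : ContMDiff (IN.prod IE) IE ∞ F)
    (h₀ : ∀ x, F (x, e₀) = e₀) : DifferentiableAt (F := VE →L[ℝ] VE) ℝ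
      (fun x => mfderiv IE IE (fun e => F ((extChartAt IN x₀).symm x, e)) e₀)
      (extChartAt IN x₀ x₀) := by
  refine DifferentiableAt.congr_of_eventuallyEq ?_ (eventually_mfderiv_eq_chartFamily hF h₀)
  have h2 : DifferentiableAt ℝ (fderiv ℝ (chartFamily IN IE F x₀ e₀))
      (extChartAt IN x₀ x₀, extChartAt IE e₀ e₀) :=
    ((contDiffAt_chartFamily hF (h₀ x₀)).fderiv_right (m := ∞) (by simp)).differentiableAt
      (by simp)
  exact ((HasFDerivAt.comp _ (g := fderiv ℝ (chartFamily IN IE F x₀ e₀))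
    (f := fun x => (x, extChartAt IE e₀ e₀)) h2.hasFDerivAt (hasFDerivAt_prodMk_left _ _)).clm_comp
      (hasFDerivAt_const (ContinuousLinearMap.inr ℝ VN VE) _)).differentiableAt

end FixedPoint

/-! ### The Lie algebra of a Lie crossed module -/

section CrossedModule

open Filter Topology

variable {VG : Type*} [NormedAddCommGroup VG] [NormedSpace ℝ VG]
  {HG : Type*} [TopologicalSpace HG] {IG : ModelWithCorners ℝ VG HG} [IG.Boundaryless]
  {VE : Type*} [NormedAddCommGroup VE] [NormedSpace ℝ VE]
  {HE : Type*} [TopologicalSpace HE] {IE : ModelWithCorners ℝ VE HE} [IE.Boundaryless]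
  {G : Type*} [TopologicalSpace G] [ChartedSpace HG G] [Group G] [LieGroup IG ∞ G]
  {E : Type*} [TopologicalSpace E] [ChartedSpace HE E] [Group E] [LieGroup IE ∞ E]

/-- The derivative at `1` of the adjoint action of a Lie group, which assigns to `e` the derivative
at `1` of `f ↦ e f e⁻¹`, is antisymmetric. -/
theorem fderiv_adjoint_antisymm (a b : VE) :
    fderiv ℝ (F := VE →L[ℝ] VE) (fun x => mfderiv IE IE
      (fun f : E => (extChartAt IE (1 : E)).symm x * f * ((extChartAt IE (1 : E)).symm x)⁻¹) 1)
      (extChartAt IE (1 : E) 1) a b =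
    -fderiv ℝ (F := VE →L[ℝ] VE) (fun x => mfderiv IE IE
      (fun f : E => (extChartAt IE (1 : E)).symm x * f * ((extChartAt IE (1 : E)).symm x)⁻¹) 1)
      (extChartAt IE (1 : E) 1) b a := by
  let ψ := extChartAt IE (1 : E)
  let C : E × E → E := fun z => z.1 * z.2 * z.1⁻¹
  let Mu : E × E → E := fun z => z.1 * z.2
  have hMu : ContMDiff (IE.prod IE) IE ∞ Mu := contMDiff_fst.mul contMDiff_snd
  have hC : ContMDiff (IE.prod IE) IE ∞ C := hMu.mul contMDiff_fst.inv
  have hev := eventually_mfderiv_eq_chartFamily (IN := IE) (IE := IE) (x₀ := (1 : E))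
    (e₀ := (1 : E)) (F := C) hC (by simp [C])
  have hev' := Filter.EventuallyEq.fderiv_eq (𝕜 := ℝ) (F := VE →L[ℝ] VE) hev
  have ho : ψ.symm (ψ 1) = 1 := extChartAt_to_inv 1
  have ht : ∀ᶠ x in 𝓝 (ψ 1), x ∈ ψ.target := extChartAt_target_mem_nhds 1
  have hcont : ContinuousAt ψ.symm (ψ 1) := continuousAt_extChartAt_symm 1
  have hsrc : ψ.source ∈ 𝓝 (1 : E) := extChartAt_source_mem_nhds 1
  have hcs : ∀ᶠ z in 𝓝 (ψ 1, ψ 1), C (ψ.symm z.1, ψ.symm z.2) ∈ ψ.source := by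
    have h1 : ContinuousAt (fun z : VE × VE => C (ψ.symm z.1, ψ.symm z.2)) (ψ 1, ψ 1) := by
      refine ContinuousAt.comp (g := C) hC.continuous.continuousAt ?_
      exact (ContinuousAt.comp (g := ψ.symm) (f := Prod.fst) (x := (ψ 1, ψ 1)) hcont
        continuousAt_fst).prodMk
        (ContinuousAt.comp (g := ψ.symm) (f := Prod.snd) (x := (ψ 1, ψ 1)) hcont continuousAt_snd)
    refine h1 ?_
    simpa [ho, C] using hsrc
  change fderiv ℝ (F := VE →L[ℝ] VE) (fun x => mfderiv IE IE
      (fun f : E => C (ψ.symm x, f)) 1) (ψ 1) a b =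
    -fderiv ℝ (F := VE →L[ℝ] VE) (fun x => mfderiv IE IE
      (fun f : E => C (ψ.symm x, f)) 1) (ψ 1) b a
  rw [hev']
  refine fderiv_conjugation_antisymm (μ := chartFamily IE IE Mu 1 1)
    (contDiffAt_chartFamily hMu (by simp [Mu])) (contDiffAt_chartFamily hC (by simp [C]))
    ?_ ?_ ?_ ?_ a b
  · refine Eventually.of_forall fun x => ?_
    change ψ (C (ψ.symm x, ψ.symm (ψ 1))) = ψ 1
    simp [ho, C]
  · filter_upwards [ht] with x hx
    change ψ (C (ψ.symm (ψ 1), ψ.symm x)) = x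
    simp [ho, C, ψ.right_inv hx]
  · filter_upwards [ht] with x hx
    change ψ (Mu (ψ.symm x, ψ.symm (ψ 1))) = x
    simp [ho, Mu, ψ.right_inv hx]
  · filter_upwards [hcs] with z hz
    change ψ (Mu (ψ.symm z.1, ψ.symm z.2)) =
      ψ (Mu (ψ.symm (ψ (C (ψ.symm z.1, ψ.symm z.2))), ψ.symm z.1))
    rw [ψ.left_inv hz]
    simp [Mu, C]

namespace LieCrossedModule

variable (X : LieCrossedModule IG IE G E)

omit [IG.Boundaryless] [IE.Boundaryless] [LieGroup IG ∞ G] [LieGroup IE ∞ E] in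
theorem mdifferentiable_act (g : G) : MDifferentiable IE IE (fun e : E => X.act g e) :=
  (X.contMDiff_act.comp (contMDiff_const.prodMk contMDiff_id)).mdifferentiable (by simp)

omit [IG.Boundaryless] [IE.Boundaryless] [LieGroup IG ∞ G] [LieGroup IE ∞ E] in
theorem groupAct_mul (g h : G) : X.groupAct (g * h) = (X.groupAct g).comp (X.groupAct h) := by
  have h1 : HasMFDerivAt IE IE (fun e : E => X.act g (X.act h e)) 1
      ((mfderiv IE IE (fun e : E => X.act g e) (X.act h 1)).comp
        (mfderiv IE IE (fun e : E => X.act h e) 1)) :=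
    HasMFDerivAt.comp 1 (X.mdifferentiable_act g _).hasMFDerivAt
      (X.mdifferentiable_act h 1).hasMFDerivAt
  have h2 : (fun e : E => X.act g (X.act h e)) = fun e => X.act (g * h) e := by
    ext e
    simp
  rw [h2] at h1
  have h3 := @congrArg E (VE →L[ℝ] VE) _ _ (fun p => mfderiv IE IE (fun e : E => X.act g e) p)
    (map_one (X.act h))
  have h4 := hasMFDerivAt_unique (X.mdifferentiable_act (g * h) 1).hasMFDerivAt h1
  exact h4.trans (congrArg (fun L : VE →L[ℝ] VE => L.comp (X.groupAct h)) h3)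

omit [IG.Boundaryless] [IE.Boundaryless] [LieGroup IG ∞ G] [LieGroup IE ∞ E] in
theorem groupAct_one : X.groupAct 1 = ContinuousLinearMap.id ℝ VE := by
  have h : (fun e : E => X.act 1 e) = id := by
    ext e
    simp
  have h1 := (X.mdifferentiable_act 1 1).hasMFDerivAt
  have h2 := hasMFDerivAt_id (I := IE) (1 : E)
  rw [← h] at h2
  exact hasMFDerivAt_unique h1 h2

/-- In the preferred chart at `1`, the derivative of `g ↦ (g ▷ ·)` is the derived action. The
differentiability needed to rule out a junk value of `derivedAct` is part of the claim. -/
theorem hasFDerivAt_groupAct :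
    HasFDerivAt (fun x => X.groupAct ((extChartAt IG (1 : G)).symm x)) X.derivedAct
      (extChartAt IG (1 : G) 1) := by
  have h1 := differentiableAt_mfderiv_fixed (IN := IG) (IE := IE) (x₀ := (1 : G)) (e₀ := (1 : E))
    X.contMDiff_act (by simp)
  have h2 : MDifferentiableAt IG 𝓘(ℝ, VE →L[ℝ] VE) (fun g : G => X.groupAct g) 1 := by
    have h3 : MDifferentiableAt 𝓘(ℝ, VG) 𝓘(ℝ, VE →L[ℝ] VE)
        (fun x => X.groupAct ((extChartAt IG (1 : G)).symm x)) (extChartAt IG (1 : G) 1) :=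
      DifferentiableAt.mdifferentiableAt h1
    refine (MDifferentiableAt.comp 1 h3
      (mdifferentiableAt_extChartAt (mem_chart_source HG (1 : G)))).congr_of_eventuallyEq ?_
    filter_upwards [extChartAt_source_mem_nhds (I := IG) (1 : G)] with g hg
    simp only [Function.comp_apply, (extChartAt IG (1 : G)).left_inv hg]
  exact HasMFDerivAt.hasFDerivAt_chart (D := X.derivedAct) h2.hasMFDerivAt rfl

/-- The derivative of `g ↦ (g⁻¹ ▷ ·)` at `1`, from that of `g ↦ (g ▷ ·)` by differentiating
`(g ▷ ·) ∘ (g⁻¹ ▷ ·) = id`. -/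
theorem hasFDerivAt_groupAct_inv :
    HasFDerivAt (fun x => X.groupAct ((extChartAt IG (1 : G)).symm x)⁻¹) (-X.derivedAct)
      (extChartAt IG (1 : G) 1) := by
  have h1 : ContMDiff (IG.prod IE) IE ∞ fun q : G × E => X.act q.1⁻¹ q.2 :=
    X.contMDiff_act.comp (contMDiff_fst.inv.prodMk contMDiff_snd)
  have h2 : DifferentiableAt ℝ (fun x => X.groupAct ((extChartAt IG (1 : G)).symm x)⁻¹)
      (extChartAt IG (1 : G) 1) :=
    differentiableAt_mfderiv_fixed (IN := IG) (IE := IE) (x₀ := (1 : G)) (e₀ := (1 : E))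
      h1 (by simp)
  have h3 := X.hasFDerivAt_groupAct.clm_comp h2.hasFDerivAt
  have h4 : (fun x => (X.groupAct ((extChartAt IG (1 : G)).symm x)).comp
      (X.groupAct ((extChartAt IG (1 : G)).symm x)⁻¹)) = fun _ => ContinuousLinearMap.id ℝ VE := by
    ext1 x
    rw [← groupAct_mul, mul_inv_cancel, groupAct_one]
  rw [h4] at h3
  have h5 := h3.unique (hasFDerivAt_const _ _)
  have h6 : -X.derivedAct = fderiv ℝ (fun x => X.groupAct ((extChartAt IG (1 : G)).symm x)⁻¹)
      (extChartAt IG (1 : G) 1) := by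
    ext a b
    have h7 := DFunLike.congr_fun (DFunLike.congr_fun h5 a) b
    simp only [extChartAt_to_inv, inv_one, groupAct_one] at h7
    simp at h7
    simp
    exact (eq_neg_of_add_eq_zero_left h7).symm
  rw [h6]
  exact h2.hasFDerivAt

/-- The Peiffer lifting `(a, b) ↦ ∂a ▷ b` on the Lie algebra of `E` is antisymmetric: by the Peiffer
identity `∂(e) ▷ f = e f e⁻¹` it is the derivative of the adjoint action of `E`. -/
theorem derivedAct_dBd_antisymm (a b : VE) :
    X.derivedAct (X.dBd a) b = -X.derivedAct (X.dBd b) a := by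
  have hbd : MDifferentiableAt IE IG X.bd (1 : E) := (X.contMDiff_bd 1).mdifferentiableAt (by simp)
  have hcd : HasFDerivAt (fun v => extChartAt IG (1 : G) (X.bd ((extChartAt IE (1 : E)).symm v)))
      X.dBd (extChartAt IE (1 : E) 1) :=
    HasMFDerivAt.hasFDerivAt_chart (D := X.dBd) hbd.hasMFDerivAt (map_one X.bd)
  have h2 : HasFDerivAt (fun x => X.groupAct ((extChartAt IG (1 : G)).symm x)) X.derivedAct
      (extChartAt IG (1 : G) (X.bd ((extChartAt IE (1 : E)).symm (extChartAt IE (1 : E) 1)))) := by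
    rw [extChartAt_to_inv, map_one]
    exact X.hasFDerivAt_groupAct
  have h3 := HasFDerivAt.comp (extChartAt IE (1 : E) 1) h2 hcd
  have hcont : ContinuousAt (fun v => X.bd ((extChartAt IE (1 : E)).symm v))
      (extChartAt IE (1 : E) 1) :=
    ContinuousAt.comp (g := X.bd) X.contMDiff_bd.continuous.continuousAt
      (continuousAt_extChartAt_symm 1)
  have hs : ∀ᶠ v in 𝓝 (extChartAt IE (1 : E) 1),
      X.bd ((extChartAt IE (1 : E)).symm v) ∈ (extChartAt IG (1 : G)).source := by
    refine hcont ?_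
    simp only [extChartAt_to_inv, map_one]
    exact extChartAt_source_mem_nhds 1
  have h4 : (fun x => mfderiv IE IE
      (fun f : E => (extChartAt IE (1 : E)).symm x * f * ((extChartAt IE (1 : E)).symm x)⁻¹) 1)
      =ᶠ[𝓝 (extChartAt IE (1 : E) 1)] ((fun x => X.groupAct ((extChartAt IG (1 : G)).symm x)) ∘
        fun v => extChartAt IG (1 : G) (X.bd ((extChartAt IE (1 : E)).symm v)) :
          VE → VE →L[ℝ] VE) := by
    filter_upwards [hs] with v hv
    have h5 := (extChartAt IG (1 : G)).left_inv hv
    simp only [Function.comp_apply, h5]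
    exact (@congrArg (E → E) (VE →L[ℝ] VE) _ _ (fun f => mfderiv IE IE f 1)
      (funext fun f => X.act_bd ((extChartAt IE (1 : E)).symm v) f)).symm
  have h5 := (h3.congr_of_eventuallyEq h4).fderiv
  have h6 := fderiv_adjoint_antisymm (IE := IE) (E := E) a b
  rw [h5] at h6
  exact h6

end LieCrossedModule

end CrossedModule

/-! ### The exterior derivative on a manifold -/

section Forms

open Filter Topology

variable {V : Type*} [NormedAddCommGroup V] [NormedSpace ℝ V]
  {H : Type*} [TopologicalSpace H] {I : ModelWithCorners ℝ V H}
  {P : Type*} [TopologicalSpace P] [ChartedSpace H P]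
  {F : Type*} [NormedAddCommGroup F] [NormedSpace ℝ F]
  {W : Type*} [NormedAddCommGroup W] [NormedSpace ℝ W]
  {n : ℕ} {a : DForm I P F n}

namespace DForm

/-- A change of base point for vectors of the model space, where rewriting with `h` would have to
transport the tangent vectors. -/
theorem apply_congr_base (a : DForm I P F n) {p q : P} (h : p = q) (v : Fin n → V) :
    a p v = a q v := by
  subst h
  rfl

theorem inChart_extChartAt_apply (a : DForm I P F n) {x₀ p : P}
    (hp : p ∈ (extChartAt I x₀).source) (v : Fin n → V) :
    a.inChart x₀ (extChartAt I x₀ p) v = a p fun i =>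
      (mfderivWithin 𝓘(ℝ, V) I (extChartAt I x₀).symm (Set.range I) (extChartAt I x₀ p) :
        V →L[ℝ] V) (v i) :=
  a.apply_congr_base ((extChartAt I x₀).left_inv hp) fun i =>
    (mfderivWithin 𝓘(ℝ, V) I (extChartAt I x₀).symm (Set.range I) (extChartAt I x₀ p) :
      V →L[ℝ] V) (v i)

theorem IsSmooth.contDiffAt_inChart [I.Boundaryless] (ha : a.IsSmooth) (x₀ : P) {y : V}
    (hy : y ∈ (extChartAt I x₀).target) : ContDiffAt ℝ ∞ (a.inChart x₀) y :=
  (ha x₀).contDiffAt ((isOpen_extChartAt_target x₀).mem_nhds hy)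

variable [IsManifold I ∞ P]

/-- At the base point of a preferred chart, the chart expression of a form is the form itself: the
derivative of the chart there is the identity. -/
theorem inChart_self_apply (a : DForm I P F n) (x : P) (v : Fin n → V) :
    a.inChart x (extChartAt I x x) v = a x v := by
  have : IsManifold I 1 P := .of_le (n := ∞) (by simp)
  have h : (mfderivWithin 𝓘(ℝ, V) I (extChartAt I x).symm (Set.range I) (extChartAt I x x) :
      V →L[ℝ] V) = ContinuousLinearMap.id ℝ V := mfderivWithin_range_extChartAt_symm
  rw [inChart_extChartAt_apply a (mem_extChartAt_source x), h]
  rfl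

variable [I.Boundaryless]

theorem d_apply (a : DForm I P F n) (x : P) (v : Fin (n + 1) → V) :
    a.d x v = extDeriv (a.inChart x) (extChartAt I x x) v := by
  have : IsManifold I 1 P := .of_le (n := ∞) (by simp)
  have h : (mfderiv I 𝓘(ℝ, V) (extChartAt I x) x : V →L[ℝ] V) = ContinuousLinearMap.id ℝ V :=
    mfderiv_extChartAt_self
  have h1 : a.d x v = extDerivWithin (a.inChart x) (Set.range I) (extChartAt I x x)
    fun i => (mfderiv I 𝓘(ℝ, V) (extChartAt I x) x : V →L[ℝ] V) (v i) := rfl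
  rw [h1, h, I.range_eq_univ, extDerivWithin_univ]
  rfl

/-- The exterior derivative commutes with pullback along a smooth map `f` from a vector space. The
pullback `α` of `a` only has to be known near the point of interest. -/
theorem extDeriv_of_pullback (ha : a.IsSmooth) {f : W → P} {f' : W → W →L[ℝ] V} {y₀ : W}
    (hf : ContMDiffAt 𝓘(ℝ, W) I ∞ f y₀)
    (hf' : ∀ᶠ y in 𝓝 y₀, HasMFDerivAt 𝓘(ℝ, W) I f y (f' y))
    {α : W → W [⋀^Fin n]→L[ℝ] F}
    (hα : ∀ᶠ y in 𝓝 y₀, ∀ v : Fin n → W, α y v = a (f y) fun i => f' y (v i))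
    (v : Fin (n + 1) → W) :
    extDeriv α y₀ v = a.d (f y₀) fun i => f' y₀ (v i) := by
  have : IsManifold I 1 P := .of_le (n := ∞) (by simp)
  let χ := extChartAt I (f y₀)
  let g : W → V := fun y => χ (f y)
  have hg : ContDiffAt ℝ ∞ g y₀ := by
    rw [← contMDiffAt_iff_contDiffAt]
    exact ContMDiffAt.comp (g := χ) (I' := I) y₀ contMDiffAt_extChartAt hf
  have hsrc : ∀ᶠ y in 𝓝 y₀, f y ∈ χ.source :=
    hf.continuousAt (extChartAt_source_mem_nhds (f y₀))
  let Dχ : P → V →L[ℝ] V := fun p => mfderiv I 𝓘(ℝ, V) χ p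
  let Dχs : V → V →L[ℝ] V := fun y => mfderivWithin 𝓘(ℝ, V) I χ.symm (Set.range I) y
  have hgd : ∀ y, HasMFDerivAt 𝓘(ℝ, W) I f y (f' y) → f y ∈ χ.source →
      HasFDerivAt g ((Dχ (f y)).comp (f' y)) y := by
    intro y hy hs
    have h1 : MDifferentiableAt I 𝓘(ℝ, V) χ (f y) :=
      mdifferentiableAt_extChartAt (by rwa [← extChartAt_source I])
    exact (HasMFDerivAt.comp y h1.hasMFDerivAt hy).hasFDerivAt
  have hinv : ∀ p ∈ χ.source, ∀ w : V, Dχs (χ p) (Dχ p w) = w := by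
    intro p hp w
    exact DFunLike.congr_fun (mfderivWithin_extChartAt_symm_comp_mfderiv_extChartAt' hp) w
  have hαg : α =ᶠ[𝓝 y₀] fun y =>
      (a.inChart (f y₀) (g y)).compContinuousLinearMap (fderiv ℝ g y) := by
    filter_upwards [hf', hsrc, hα] with y h1 h2 h3
    ext w
    rw [h3, (hgd y h1 h2).fderiv]
    refine Eq.trans ?_ (inChart_extChartAt_apply a h2 _).symm
    refine congrArg (a (f y) : (Fin n → V) → F) (funext fun i => ?_)
    exact (hinv (f y) h2 (f' y (w i))).symm
  have hω : DifferentiableAt ℝ (a.inChart (f y₀)) (g y₀) :=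
    (ha.contDiffAt_inChart (f y₀) (mem_extChartAt_target (f y₀))).differentiableAt (by simp)
  rw [hαg.extDeriv_eq, extDeriv_pullback hω hg (by
    rw [minSmoothness_of_isRCLikeNormedField]
    exact WithTop.coe_le_coe.2 le_top), (hgd y₀ hf'.self_of_nhds hsrc.self_of_nhds).fderiv]
  refine Eq.trans ?_ (a.d_apply (f y₀) _).symm
  have h : Dχ (f y₀) = ContinuousLinearMap.id ℝ V := mfderiv_extChartAt_self
  rw [h]
  rfl

theorem hasMFDerivAt_extChartAt_symm (x₀ : P) {y : V} (hy : y ∈ (extChartAt I x₀).target) :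
    HasMFDerivAt 𝓘(ℝ, V) I (extChartAt I x₀).symm y
      (mfderivWithin 𝓘(ℝ, V) I (extChartAt I x₀).symm (Set.range I) y) := by
  have : IsManifold I 1 P := .of_le (n := ∞) (by simp)
  have h := (mdifferentiableWithinAt_extChartAt_symm hy).hasMFDerivWithinAt
  rwa [I.range_eq_univ, hasMFDerivWithinAt_univ, ← I.range_eq_univ] at h

/-- The exterior derivative can be computed in any preferred chart. -/
theorem inChart_d (ha : a.IsSmooth) (x₀ : P) {y : V} (hy : y ∈ (extChartAt I x₀).target) :
    a.d.inChart x₀ y = extDeriv (a.inChart x₀) y := by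
  ext v
  symm
  exact extDeriv_of_pullback ha (contMDiffAt_extChartAt_symm x₀ hy)
    (((isOpen_extChartAt_target x₀).eventually_mem hy).mono
      fun z hz => hasMFDerivAt_extChartAt_symm x₀ hz)
    (Eventually.of_forall fun z w => rfl) v

/-- The exterior derivative commutes with pullback along a smooth self-map `f` of `P`. -/
theorem d_of_pullback (ha : a.IsSmooth) {f : P → P} (hf : ContMDiff I I ∞ f) {b : DForm I P F n}
    (hb : ∀ p (v : Fin n → V), b p v = a (f p) fun i => (mfderiv I I f p : V →L[ℝ] V) (v i))
    (p : P) (v : Fin (n + 1) → V) :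
    b.d p v = a.d (f p) fun i => (mfderiv I I f p : V →L[ℝ] V) (v i) := by
  have : IsManifold I 1 P := .of_le (n := ∞) (by simp)
  let χ := extChartAt I p
  let Dχs : V → V →L[ℝ] V := fun y => mfderivWithin 𝓘(ℝ, V) I χ.symm (Set.range I) y
  let Df : P → V →L[ℝ] V := fun q => mfderiv I I f q
  have hmem := mem_extChartAt_target (I := I) p
  have hs : ContMDiffAt 𝓘(ℝ, V) I ∞ (fun y => f (χ.symm y)) (χ p) :=
    ContMDiffAt.comp (g := f) (I' := I) _ (hf _) (contMDiffAt_extChartAt_symm p hmem)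
  have h1 := extDeriv_of_pullback ha (f' := fun y => (Df (χ.symm y)).comp (Dχs y)) hs
    (((isOpen_extChartAt_target p).eventually_mem hmem).mono
      fun z hz => HasMFDerivAt.comp z
        (hf.mdifferentiable (by simp) (χ.symm z)).hasMFDerivAt (hasMFDerivAt_extChartAt_symm p hz))
    (α := b.inChart p) (Eventually.of_forall fun z w => hb _ _) v
  rw [d_apply]
  refine h1.trans ?_
  have h2 : Dχs (χ p) = ContinuousLinearMap.id ℝ V := mfderivWithin_range_extChartAt_symm
  have h3 : χ.symm (χ p) = p := extChartAt_to_inv p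
  rw [h2, h3]
  rfl

end DForm

end Forms

/-! ### Horizontal projections and right translations on a principal bundle -/

section Bundle

open Filter Topology

variable {VG : Type*} [NormedAddCommGroup VG] [NormedSpace ℝ VG]
  {HG : Type*} [TopologicalSpace HG] {IG : ModelWithCorners ℝ VG HG}
  {VE : Type*} [NormedAddCommGroup VE] [NormedSpace ℝ VE]
  {HE : Type*} [TopologicalSpace HE] {IE : ModelWithCorners ℝ VE HE}
  {VM : Type*} [NormedAddCommGroup VM] [NormedSpace ℝ VM]
  {HM : Type*} [TopologicalSpace HM] {IM : ModelWithCorners ℝ VM HM}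
  {VP : Type*} [NormedAddCommGroup VP] [NormedSpace ℝ VP]
  {HP : Type*} [TopologicalSpace HP] {IP : ModelWithCorners ℝ VP HP}
  {G : Type*} [TopologicalSpace G] [ChartedSpace HG G] [Group G]
  {E : Type*} [TopologicalSpace E] [ChartedSpace HE E] [Group E]
  {M : Type*} [TopologicalSpace M] [ChartedSpace HM M]
  {P : Type*} [TopologicalSpace P] [ChartedSpace HP P]

/-- The value of a one-form at a point, as a linear map on the model space. -/
def DForm.toLinear (θ : DForm IP P VG 1) (u : P) : VP →L[ℝ] VG :=
  (ContinuousAlternatingMap.ofSubsingleton ℝ VP VG (0 : Fin 1)).symm (θ u)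

theorem DForm.toLinear_apply (θ : DForm IP P VG 1) (u : P) (v : VP) :
    θ.toLinear u v = θ u fun _ => v := rfl

/-- The expression of a one-form in the preferred chart at `x₀`, as a field of linear maps. -/
def DForm.linearInChart (θ : DForm IP P VG 1) (x₀ : P) (y : VP) : VP →L[ℝ] VG :=
  (ContinuousAlternatingMap.ofSubsingletonLIE (𝕜 := ℝ) (E := VP) (F := VG) (0 : Fin 1)).symm
    (θ.inChart x₀ y)

theorem DForm.linearInChart_apply (θ : DForm IP P VG 1) (x₀ : P) (y v : VP) :
    θ.linearInChart x₀ y v = θ.inChart x₀ y fun _ => v := rfl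

theorem DForm.IsSmooth.linearInChart {θ : DForm IP P VG 1} (hθ : θ.IsSmooth) (x₀ : P) :
    ContDiffOn ℝ ∞ (θ.linearInChart x₀) (extChartAt IP x₀).target :=
  (ContinuousAlternatingMap.ofSubsingletonLIE (𝕜 := ℝ) (E := VP) (F := VG)
    (0 : Fin 1)).symm.toContinuousLinearEquiv.contDiff.comp_contDiffOn (hθ x₀)

namespace SmoothPrincipalBundle

variable (B : SmoothPrincipalBundle IG IM IP G M P) {θ : DForm IP P VG 1}

theorem contMDiff_act_right (g : G) : ContMDiff IP IP ∞ fun u => B.act u g :=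
  B.contMDiff_act.comp (contMDiff_id.prodMk contMDiff_const)

theorem contMDiff_act_left (u : P) : ContMDiff IG IP ∞ fun g => B.act u g :=
  B.contMDiff_act.comp (contMDiff_const.prodMk contMDiff_id)

/-- The derivative of the right translation `R_g` at `u`, as a linear map on the model space. -/
def rightDeriv (g : G) (u : P) : VP →L[ℝ] VP :=
  mfderiv IP IP (fun u => B.act u g) u

/-- The derivative of the orbit map `g ↦ u g` at `g`, as a map between the model spaces. -/
def orbitDeriv (u : P) (g : G) : VG →L[ℝ] VP :=
  mfderiv IG IP (fun g => B.act u g) g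

/-- The map `A ↦ A^#_u`, as a map between the model spaces. -/
def vertical (u : P) : VG →L[ℝ] VP := B.fundamental u

theorem hasMFDerivAt_right (g : G) (u : P) :
    HasMFDerivAt IP IP (fun u => B.act u g) u (B.rightDeriv g u) :=
  ((B.contMDiff_act_right g).mdifferentiable (by simp) u).hasMFDerivAt

theorem hasMFDerivAt_orbit (u : P) (g : G) :
    HasMFDerivAt IG IP (fun g => B.act u g) g (B.orbitDeriv u g) :=
  ((B.contMDiff_act_left u).mdifferentiable (by simp) g).hasMFDerivAt

theorem rightDeriv_one (u : P) : B.rightDeriv 1 u = ContinuousLinearMap.id ℝ VP := by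
  have h := B.hasMFDerivAt_right 1 u
  have h1 : (fun u => B.act u 1) = id := funext B.act_one
  rw [h1] at h
  exact hasMFDerivAt_unique h (hasMFDerivAt_id u)

/-- Tangent vectors to the orbits of `G` are values of fundamental vector fields. -/
theorem exists_fundamental_eq_orbitDeriv [LieGroup IG ∞ G] (u : P) (g : G) (Y : VG) :
    ∃ A : VG, B.vertical (B.act u g) A = B.orbitDeriv u g Y := by
  have h1 : HasMFDerivAt IG IG (fun g' : G => g⁻¹ * g') g _ :=
    ((contMDiff_mul_left (I := IG) (n := ∞) (a := g⁻¹) g).mdifferentiableAt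
      (by simp)).hasMFDerivAt
  have h2 := HasMFDerivAt.comp g (B.hasMFDerivAt_orbit (B.act u g) (g⁻¹ * g)) h1
  have h3 : ((fun g' => B.act (B.act u g) g') ∘ fun g' : G => g⁻¹ * g') = fun g' => B.act u g' := by
    funext g'
    simp [← B.act_mul]
  rw [h3] at h2
  have h4 := DFunLike.congr_fun (hasMFDerivAt_unique (B.hasMFDerivAt_orbit u g) h2) Y
  refine ⟨(mfderiv IG IG (fun g' : G => g⁻¹ * g') g : VG →L[ℝ] VG) Y, ?_⟩
  refine Eq.trans ?_ h4.symm
  have h5 := congrArg (B.orbitDeriv (B.act u g)) (inv_mul_cancel g)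
  exact (DFunLike.congr_fun h5 _).symm

/-- Right translation maps `A^#` to `(g⁻¹ A g)^#`. -/
theorem rightDeriv_fundamental [LieGroup IG ∞ G] (g : G) (u : P) (A : VG) :
    B.rightDeriv g u (B.vertical u A) =
      B.vertical (B.act u g) (adjointAction IG g⁻¹ A) := by
  let c : G → G := fun x => g⁻¹ * x * g⁻¹⁻¹
  have hc : ContMDiff IG IG ∞ c := (contMDiff_const.mul contMDiff_id).mul contMDiff_const
  have h1 : HasMFDerivAt IG IG c 1 (adjointAction IG g⁻¹ : VG →L[ℝ] VG) :=
    (hc.mdifferentiable (by simp) 1).hasMFDerivAt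
  have h2 := HasMFDerivAt.comp (1 : G) (B.hasMFDerivAt_orbit (B.act u g) (c 1)) h1
  have h3 := HasMFDerivAt.comp (1 : G) (B.hasMFDerivAt_right g (B.act u 1))
    (B.hasMFDerivAt_orbit u 1)
  have h4 : ((fun g' => B.act (B.act u g) g') ∘ c) =
      (fun u => B.act u g) ∘ fun x => B.act u x := by
    funext x
    simp [← B.act_mul, c, mul_assoc]
  rw [h4] at h2
  have h5 := DFunLike.congr_fun (hasMFDerivAt_unique h3 h2) A
  have h6 := congrArg (B.rightDeriv g) (B.act_one u)
  have h7 := congrArg (B.orbitDeriv (B.act u g)) (show c 1 = 1 by simp [c])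
  exact (DFunLike.congr_fun h6 _).symm.trans (h5.trans (DFunLike.congr_fun h7 _))

/-- The horizontal projection at `u`, as an endomorphism of the model space. -/
def horProj (θ : DForm IP P VG 1) (u : P) : VP →L[ℝ] VP := B.horizontalPart θ u

theorem horProj_apply (θ : DForm IP P VG 1) (u : P) (v : VP) :
    B.horProj θ u v = v - B.vertical u (θ.toLinear u v) := rfl

namespace IsConnection

variable {B} (hθ : B.IsConnection θ)

include hθ in
theorem toLinear_fundamental (u : P) (A : VG) : θ.toLinear u (B.vertical u A) = A :=
  hθ.fundamental u A

include hθ in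
theorem toLinear_horProj (u : P) (v : VP) : θ.toLinear u (B.horProj θ u v) = 0 := by
  rw [B.horProj_apply, map_sub, hθ.toLinear_fundamental, sub_self]

include hθ in
theorem horProj_fundamental (u : P) (A : VG) : B.horProj θ u (B.vertical u A) = 0 := by
  rw [B.horProj_apply, hθ.toLinear_fundamental, sub_self]

include hθ in
theorem horProj_horProj (u : P) (v : VP) :
    B.horProj θ u (B.horProj θ u v) = B.horProj θ u v := by
  rw [B.horProj_apply (v := B.horProj θ u v), hθ.toLinear_horProj, map_zero, sub_zero]

include hθ in
theorem compHorizontal_compHorizontal {F : Type*} [NormedAddCommGroup F] [NormedSpace ℝ F] {n : ℕ}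
    (a : DForm IP P F n) :
    B.compHorizontal θ (B.compHorizontal θ a) = B.compHorizontal θ a := by
  funext u
  refine ContinuousAlternatingMap.ext fun v => ?_
  exact congrArg (a u : (Fin n → VP) → F) (funext fun i => hθ.horProj_horProj u (v i))

include hθ in
theorem toLinear_rightDeriv (g : G) (u : P) (v : VP) :
    θ.toLinear (B.act u g) (B.rightDeriv g u v) = adjointAction IG g⁻¹ (θ.toLinear u v) :=
  DFunLike.congr_fun (hθ.equivariant g u) fun _ => v

include hθ in
/-- The horizontal distribution is invariant under right translations. -/
theorem horProj_rightDeriv [LieGroup IG ∞ G] (g : G) (u : P) (v : VP) :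
    B.horProj θ (B.act u g) (B.rightDeriv g u v) = B.rightDeriv g u (B.horProj θ u v) := by
  rw [B.horProj_apply, B.horProj_apply, hθ.toLinear_rightDeriv, map_sub, B.rightDeriv_fundamental]

end IsConnection

end SmoothPrincipalBundle

end Bundle

/-! ### The structure equation for the covariant derivative -/

section Covariant

open Filter Topology

variable {VG : Type*} [NormedAddCommGroup VG] [NormedSpace ℝ VG]
  {HG : Type*} [TopologicalSpace HG] {IG : ModelWithCorners ℝ VG HG} [IG.Boundaryless]
  {VE : Type*} [NormedAddCommGroup VE] [NormedSpace ℝ VE]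
  {HE : Type*} [TopologicalSpace HE] {IE : ModelWithCorners ℝ VE HE} [IE.Boundaryless]
  {VM : Type*} [NormedAddCommGroup VM] [NormedSpace ℝ VM]
  {HM : Type*} [TopologicalSpace HM] {IM : ModelWithCorners ℝ VM HM}
  {VP : Type*} [NormedAddCommGroup VP] [NormedSpace ℝ VP]
  {HP : Type*} [TopologicalSpace HP] {IP : ModelWithCorners ℝ VP HP} [IP.Boundaryless]
  {G : Type*} [TopologicalSpace G] [ChartedSpace HG G] [Group G] [LieGroup IG ∞ G]
  {E : Type*} [TopologicalSpace E] [ChartedSpace HE E] [Group E] [LieGroup IE ∞ E]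
  {M : Type*} [TopologicalSpace M] [ChartedSpace HM M]
  {P : Type*} [TopologicalSpace P] [ChartedSpace HP P] [IsManifold IP ∞ P]

namespace SmoothPrincipalBundle

variable {B : SmoothPrincipalBundle IG IM IP G M P} {θ : DForm IP P VG 1}

variable (B) in
/-- The action map `(u, g) ↦ u g` with both arguments in the preferred charts at `u₀` and `1`. -/
def chartAction (u₀ : P) (z : VP × VG) : P :=
  B.act ((extChartAt IP u₀).symm z.1) ((extChartAt IG (1 : G)).symm z.2)

variable (B) in
theorem contMDiffAt_chartAction (u₀ : P) {z : VP × VG} (h₁ : z.1 ∈ (extChartAt IP u₀).target)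
    (h₂ : z.2 ∈ (extChartAt IG (1 : G)).target) :
    ContMDiffAt 𝓘(ℝ, VP × VG) IP ∞ (B.chartAction u₀) z := by
  have h1 : ContMDiffAt 𝓘(ℝ, VP × VG) IP ∞ (fun z : VP × VG => (extChartAt IP u₀).symm z.1) z :=
    ContMDiffAt.comp (g := (extChartAt IP u₀).symm) (I' := 𝓘(ℝ, VP)) _
      (contMDiffAt_extChartAt_symm u₀ h₁) contDiff_fst.contMDiff.contMDiffAt
  have h2 : ContMDiffAt 𝓘(ℝ, VP × VG) IG ∞
      (fun z : VP × VG => (extChartAt IG (1 : G)).symm z.2) z :=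
    ContMDiffAt.comp (g := (extChartAt IG (1 : G)).symm) (I' := 𝓘(ℝ, VG)) _
      (contMDiffAt_extChartAt_symm 1 h₂) contDiff_snd.contMDiff.contMDiffAt
  exact ContMDiffAt.comp (I' := IP.prod IG) _ (B.contMDiff_act _) (h1.prodMk h2)

variable (B) in
/-- The derivative of the action map in charts. -/
def chartActionDeriv (u₀ : P) (z : VP × VG) : VP × VG →L[ℝ] VP :=
  mfderiv 𝓘(ℝ, VP × VG) IP (B.chartAction u₀) z

variable (B) in
/-- The product rule for the action map. -/
theorem chartActionDeriv_apply (u₀ : P) {z : VP × VG} (h₁ : z.1 ∈ (extChartAt IP u₀).target)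
    (h₂ : z.2 ∈ (extChartAt IG (1 : G)).target) (w : VP × VG) :
    B.chartActionDeriv u₀ z w =
      B.rightDeriv ((extChartAt IG (1 : G)).symm z.2) ((extChartAt IP u₀).symm z.1)
        ((mfderivWithin 𝓘(ℝ, VP) IP (extChartAt IP u₀).symm (Set.range IP) z.1 : VP →L[ℝ] VP)
          w.1) +
      B.orbitDeriv ((extChartAt IP u₀).symm z.1) ((extChartAt IG (1 : G)).symm z.2)
        ((mfderivWithin 𝓘(ℝ, VG) IG (extChartAt IG (1 : G)).symm (Set.range IG) z.2 :
          VG →L[ℝ] VG) w.2) := by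
  have hz : HasMFDerivAt 𝓘(ℝ, VP × VG) IP (B.chartAction u₀) (z.1, z.2)
      (B.chartActionDeriv u₀ z) :=
    ((B.contMDiffAt_chartAction u₀ h₁ h₂).mdifferentiableAt (by simp)).hasMFDerivAt
  have hl : HasMFDerivAt 𝓘(ℝ, VP) 𝓘(ℝ, VP × VG) (fun x : VP => (x, z.2)) z.1 (.inl ℝ VP VG) :=
    (hasFDerivAt_prodMk_left z.1 z.2).hasMFDerivAt
  have hr : HasMFDerivAt 𝓘(ℝ, VG) 𝓘(ℝ, VP × VG) (fun y : VG => (z.1, y)) z.2 (.inr ℝ VP VG) :=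
    (hasFDerivAt_prodMk_right z.1 z.2).hasMFDerivAt
  have h1 := HasMFDerivAt.comp z.1 hz hl
  have h2 := HasMFDerivAt.comp z.2 hz hr
  have h1' := HasMFDerivAt.comp z.1
    (B.hasMFDerivAt_right ((extChartAt IG (1 : G)).symm z.2) ((extChartAt IP u₀).symm z.1))
    (DForm.hasMFDerivAt_extChartAt_symm u₀ h₁)
  have h2' := HasMFDerivAt.comp z.2
    (B.hasMFDerivAt_orbit ((extChartAt IP u₀).symm z.1) ((extChartAt IG (1 : G)).symm z.2))
    (DForm.hasMFDerivAt_extChartAt_symm (1 : G) h₂)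
  have e1 : B.chartActionDeriv u₀ z (w.1, 0) = _ :=
    DFunLike.congr_fun (hasMFDerivAt_unique h1 h1') w.1
  have e2 : B.chartActionDeriv u₀ z (0, w.2) = _ :=
    DFunLike.congr_fun (hasMFDerivAt_unique h2 h2') w.2
  have e3 : w = (w.1, 0) + (0, w.2) := by simp
  rw [e3, map_add, e1, e2]
  simp
  rfl

namespace IsConnection

variable (hθ : B.IsConnection θ) (X : LieCrossedModule IG IE G E) {n : ℕ} {a : DForm IP P VE n}

include hθ in
/-- The structure equation `D a = d a + θ ∧^▷ a` for a horizontal equivariant form `a`. Horizontality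
and equivariance say that the pullback of `a` under the action map `(u, g) ↦ u g` is
`(g⁻¹ ▷ ·) pr₁^* a`; the equation is the exterior derivative of this identity at `g = 1`, evaluated
on the pairs `(vᵢ^H, θ(vᵢ))`, which the action map sends to `vᵢ`. -/
theorem d_apply_of_horizontal (ha : a.IsSmooth)
    (hequiv : ∀ (g : G) (u : P), B.pullbackRight g a u =
      (X.groupAct g⁻¹).compContinuousAlternatingMap (a u))
    (hhor : a = B.compHorizontal θ a) (u : P) (v : Fin (n + 1) → VP) :
    a.d u v = B.covD θ a u v - wedgeOne X.derivedAct (θ.toLinear u) (a u) v := by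
  let χ := extChartAt IP u
  let ψ := extChartAt IG (1 : G)
  have hmem : ∀ᶠ z in 𝓝 (χ u, ψ 1), z.1 ∈ χ.target ∧ z.2 ∈ ψ.target :=
    ((isOpen_extChartAt_target u).eventually_mem (mem_extChartAt_target u)).prod_nhds
      ((isOpen_extChartAt_target (1 : G)).eventually_mem (mem_extChartAt_target (1 : G)))
  have hhor' : ∀ (p : P) (w : Fin n → VP), a p w = a p fun i => B.horProj θ p (w i) :=
    fun p w => DFunLike.congr_fun (congrFun hhor p) w
  let α : VP × VG → (VP × VG) [⋀^Fin n]→L[ℝ] VE := fun z =>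
    (X.groupAct (ψ.symm z.2)⁻¹).compContinuousAlternatingMap
      ((a.inChart u z.1).compContinuousLinearMap (ContinuousLinearMap.fst ℝ VP VG))
  have hα : ∀ᶠ z in 𝓝 (χ u, ψ 1), ∀ w : Fin n → VP × VG,
      α z w = a (B.chartAction u z) fun i => B.chartActionDeriv u z (w i) := by
    filter_upwards [hmem] with z hz w
    let Dχs : VP →L[ℝ] VP := mfderivWithin 𝓘(ℝ, VP) IP χ.symm (Set.range IP) z.1
    have h1 : α z w = a (B.act (χ.symm z.1) (ψ.symm z.2)) fun i =>
        B.rightDeriv (ψ.symm z.2) (χ.symm z.1) (Dχs (w i).1) :=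
      (DFunLike.congr_fun (hequiv (ψ.symm z.2) (χ.symm z.1)) fun i => Dχs (w i).1).symm
    rw [h1]
    refine (hhor' _ _).trans (Eq.trans ?_ (hhor' _ _).symm)
    refine congrArg (a (B.act (χ.symm z.1) (ψ.symm z.2)) : (Fin n → VP) → VE) (funext fun i => ?_)
    -- The derivative of the action map in the direction of `G` is vertical, so `a` ignores it.
    obtain ⟨A, hA⟩ := B.exists_fundamental_eq_orbitDeriv (χ.symm z.1) (ψ.symm z.2)
      ((mfderivWithin 𝓘(ℝ, VG) IG ψ.symm (Set.range IG) z.2 : VG →L[ℝ] VG) (w i).2)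
    rw [B.chartActionDeriv_apply u hz.1 hz.2, ← hA, map_add]
    have h2 := hθ.horProj_fundamental (B.act (χ.symm z.1) (ψ.symm z.2)) A
    exact (left_eq_add.2 h2)
  -- Vectors of `P × G` at `(u, 1)` with horizontal first component, mapped to `vᵢ` by the action.
  let w : Fin (n + 1) → VP × VG := fun i => (B.horProj θ u (v i), θ.toLinear u (v i))
  have h3 := DForm.extDeriv_of_pullback ha (f := B.chartAction u) (f' := B.chartActionDeriv u)
    (B.contMDiffAt_chartAction u (z := (χ u, ψ 1)) (mem_extChartAt_target u)
      (mem_extChartAt_target (1 : G)))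
    (hmem.mono fun z hz =>
      ((B.contMDiffAt_chartAction u hz.1 hz.2).mdifferentiableAt (by simp)).hasMFDerivAt) hα w
  have hu : χ.symm (χ u) = u := extChartAt_to_inv u
  have h1 : ψ.symm (ψ 1) = 1 := extChartAt_to_inv 1
  have h4 := extDeriv_smul_fst (x := χ u) X.hasFDerivAt_groupAct_inv
    (by rw [extChartAt_to_inv, inv_one, X.groupAct_one])
    ((ha.contDiffAt_inChart u (mem_extChartAt_target u)).differentiableAt (by simp)) w
  have hw : ∀ i, B.chartActionDeriv u (χ u, ψ 1) (w i) = v i := by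
    intro i
    rw [B.chartActionDeriv_apply u (z := (χ u, ψ 1)) (mem_extChartAt_target u)
      (mem_extChartAt_target (1 : G))]
    have : IsManifold IP 1 P := .of_le (n := ∞) (by simp)
    have : IsManifold IG 1 G := .of_le (n := ∞) (by simp)
    have e1 : (mfderivWithin 𝓘(ℝ, VP) IP χ.symm (Set.range IP) (χ u) : VP →L[ℝ] VP) =
      ContinuousLinearMap.id ℝ VP := mfderivWithin_range_extChartAt_symm
    have e2 : (mfderivWithin 𝓘(ℝ, VG) IG ψ.symm (Set.range IG) (ψ 1) : VG →L[ℝ] VG) =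
      ContinuousLinearMap.id ℝ VG := mfderivWithin_range_extChartAt_symm
    have e3 : B.rightDeriv (ψ.symm (ψ 1)) (χ.symm (χ u)) = ContinuousLinearMap.id ℝ VP := by
      rw [h1, hu, B.rightDeriv_one]
    have e4 : B.orbitDeriv (χ.symm (χ u)) (ψ.symm (ψ 1)) = B.vertical u := by
      rw [h1, hu]
      rfl
    change B.rightDeriv (ψ.symm (ψ 1)) (χ.symm (χ u)) ((mfderivWithin 𝓘(ℝ, VP) IP χ.symm
        (Set.range IP) (χ u) : VP →L[ℝ] VP) (B.horProj θ u (v i))) +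
      B.orbitDeriv (χ.symm (χ u)) (ψ.symm (ψ 1)) ((mfderivWithin 𝓘(ℝ, VG) IG ψ.symm
        (Set.range IG) (ψ 1) : VG →L[ℝ] VG) (θ.toLinear u (v i))) = v i
    rw [e1, e2, e3, e4, B.horProj_apply]
    exact sub_add_cancel _ _
  have hbase : B.chartAction u (χ u, ψ 1) = u := by
    change B.act (χ.symm (χ u)) (ψ.symm (ψ 1)) = u
    rw [hu, h1, B.act_one]
  have h5 : a.d (B.chartAction u (χ u, ψ 1)) (fun i => B.chartActionDeriv u (χ u, ψ 1) (w i)) =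
      a.d u v := by
    refine (a.d.apply_congr_base hbase _).trans ?_
    exact congrArg (a.d u : (Fin (n + 1) → VP) → VE) (funext hw)
  rw [← h5, ← h3]
  refine h4.trans ?_
  refine Eq.trans ?_ (congrArg (B.covD θ a u v - ·)
    (wedgeOne_apply X.derivedAct (θ.toLinear u) (a u) v).symm)
  rw [sub_eq_add_neg, ← Finset.sum_neg_distrib]
  congr 1
  · exact (a.d_apply u _).symm
  · refine Finset.sum_congr rfl fun i _ => ?_
    have h6 : a.inChart u (χ u) (i.removeNth fun j => (w j).1) = a u (i.removeNth v) :=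
      (a.inChart_self_apply u _).trans (hhor' u (i.removeNth v)).symm
    have h7 : (-X.derivedAct) (w i).2 (a.inChart u (χ u) (i.removeNth fun j => (w j).1)) =
        -(X.derivedAct (θ.toLinear u (v i)) (a u (i.removeNth v))) := by
      rw [h6]
      rfl
    rw [← smul_neg]
    exact congrArg _ h7

omit [IG.Boundaryless] [IE.Boundaryless] [LieGroup IE ∞ E] in
include hθ in
/-- The exterior covariant derivative of an equivariant form is equivariant. -/
theorem covD_equivariant (ha : a.IsSmooth)
    (hequiv : ∀ (g : G) (u : P), B.pullbackRight g a u =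
      (X.groupAct g⁻¹).compContinuousAlternatingMap (a u)) (g : G) (u : P) :
    B.pullbackRight g (B.covD θ a) u =
      (X.groupAct g⁻¹).compContinuousAlternatingMap (B.covD θ a u) := by
  refine ContinuousAlternatingMap.ext fun (v : Fin (n + 1) → VP) => ?_
  let b : DForm IP P VE n := fun p => (X.groupAct g⁻¹).compContinuousAlternatingMap (a p)
  have h1 := DForm.d_of_pullback ha (B.contMDiff_act_right g) (b := b)
    (fun p w => (DFunLike.congr_fun (hequiv g p) w).symm) u fun i => B.horProj θ u (v i)
  have h2 : b.d u (fun i => B.horProj θ u (v i)) =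
      X.groupAct g⁻¹ (a.d u fun i => B.horProj θ u (v i)) := by
    rw [DForm.d_apply, DForm.d_apply]
    exact extDeriv_postcomp (X.groupAct g⁻¹)
      ((ha.contDiffAt_inChart u (mem_extChartAt_target u)).differentiableAt (by simp)) _
  refine Eq.trans ?_ (h1.symm.trans h2)
  exact congrArg (a.d (B.act u g) : (Fin (n + 1) → VP) → VE)
    (funext fun i => hθ.horProj_rightDeriv g u (v i))

end IsConnection

end SmoothPrincipalBundle

end Covariant

/-! ### The 2-Bianchi identity -/

section Bianchi

open Filter Topology

variable {VG : Type*} [NormedAddCommGroup VG] [NormedSpace ℝ VG]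
  {HG : Type*} [TopologicalSpace HG] {IG : ModelWithCorners ℝ VG HG} [IG.Boundaryless]
  {VE : Type*} [NormedAddCommGroup VE] [NormedSpace ℝ VE]
  {HE : Type*} [TopologicalSpace HE] {IE : ModelWithCorners ℝ VE HE} [IE.Boundaryless]
  {VM : Type*} [NormedAddCommGroup VM] [NormedSpace ℝ VM]
  {HM : Type*} [TopologicalSpace HM] {IM : ModelWithCorners ℝ VM HM}
  {VP : Type*} [NormedAddCommGroup VP] [NormedSpace ℝ VP]
  {HP : Type*} [TopologicalSpace HP] {IP : ModelWithCorners ℝ VP HP} [IP.Boundaryless]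
  {G : Type*} [TopologicalSpace G] [ChartedSpace HG G] [Group G] [LieGroup IG ∞ G]
  {E : Type*} [TopologicalSpace E] [ChartedSpace HE E] [Group E] [LieGroup IE ∞ E]
  {M : Type*} [TopologicalSpace M] [ChartedSpace HM M]
  {P : Type*} [TopologicalSpace P] [ChartedSpace HP P] [IsManifold IP ∞ P]

/-- The exterior derivative of a one-form is the antisymmetrisation of its derivative. -/
theorem DForm.IsSmooth.fderiv_linearInChart_sub {θ : DForm IP P VG 1} (hθ : θ.IsSmooth) (x : P)
    (v w : VP) :
    fderiv ℝ (θ.linearInChart x) (extChartAt IP x x) v w -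
      fderiv ℝ (θ.linearInChart x) (extChartAt IP x x) w v = θ.d x ![v, w] := by
  have h1 : DifferentiableAt ℝ (θ.inChart x) (extChartAt IP x x) :=
    (hθ.contDiffAt_inChart x (mem_extChartAt_target x)).differentiableAt (by simp)
  have h2 : HasFDerivAt (θ.linearInChart x) _ (extChartAt IP x x) :=
    (ContinuousAlternatingMap.ofSubsingletonLIE (𝕜 := ℝ) (E := VP) (F := VG)
      (0 : Fin 1)).symm.toContinuousLinearEquiv.hasFDerivAt.comp _ h1.hasFDerivAt
  refine Eq.trans ?_ (θ.d_apply x ![v, w]).symm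
  rw [h2.fderiv, extDeriv, ContinuousAlternatingMap.alternatizeUncurryFin_apply]
  have h3 : ∀ a b : VP, fderiv ℝ (θ.inChart x) (extChartAt IP x x) a (fun _ => b) =
      fderiv ℝ (θ.inChart x) (extChartAt IP x x) a ![b] := by
    intro a b
    congr 1
    ext i
    fin_cases i
    rfl
  have h4 : Fin.removeNth 0 ![v, w] = ![w] := by ext i; fin_cases i; rfl
  have h5 : Fin.removeNth 1 ![v, w] = ![v] := by ext i; fin_cases i; rfl
  refine Eq.trans ?_ (Fin.sum_univ_two _).symm
  refine Eq.trans (congrArg₂ (· - ·) (h3 v w) (h3 w v)) ?_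
  rw [h4, h5]
  simp [sub_eq_add_neg]

namespace SmoothPrincipalBundle.IsCategoricalConnection

variable {B : SmoothPrincipalBundle IG IM IP G M P} {θ : DForm IP P VG 1}
  {X : LieCrossedModule IG IE G E} {m : DForm IP P VE 2} (h : B.IsCategoricalConnection X θ m)

include h in
/-- The structure equation `𝓜 = dm + θ ∧^▷ m`. -/
theorem twoCurvature_apply (u : P) (v : Fin 3 → VP) :
    B.twoCurvature θ m u v = m.d u v + wedgeOne X.derivedAct (θ.toLinear u) (m u) v :=
  (sub_eq_iff_eq_add.1
    (h.connection.d_apply_of_horizontal X h.smooth h.equivariant h.horizontal u v).symm)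

include h in
/-- The structure equation in a chart, where the right-hand side is visibly smooth. -/
theorem inChart_twoCurvature (x₀ : P) {y : VP} (hy : y ∈ (extChartAt IP x₀).target) :
    (B.twoCurvature θ m).inChart x₀ y = extDeriv (m.inChart x₀) y +
      wedgeOne X.derivedAct (θ.linearInChart x₀ y) (m.inChart x₀ y) := by
  ext v
  let D : VP →L[ℝ] VP := mfderivWithin 𝓘(ℝ, VP) IP (extChartAt IP x₀).symm (Set.range IP) y
  have h1 := h.twoCurvature_apply ((extChartAt IP x₀).symm y) fun i => D (v i)
  have h2 : m.d ((extChartAt IP x₀).symm y) (fun i => D (v i)) = extDeriv (m.inChart x₀) y v :=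
    DFunLike.congr_fun (DForm.inChart_d h.smooth x₀ hy) v
  refine h1.trans (congrArg₂ (· + ·) h2 ?_)
  exact (wedgeOne_apply _ _ _ _).trans
    (wedgeOne_apply X.derivedAct (θ.linearInChart x₀ y) (m.inChart x₀ y) v).symm

include h in
theorem isSmooth_twoCurvature : (B.twoCurvature θ m).IsSmooth := fun x₀ =>
  (((h.smooth x₀).extDeriv (isOpen_extChartAt_target x₀)).add
    (ContDiffOn.wedgeOne (h.connection.smooth.linearInChart x₀) (h.smooth x₀))).congr
      fun _ hy => h.inChart_twoCurvature x₀ hy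

include h in
/-- `D𝓜 = 0`: since `d d m = 0`, this is `d(θ ∧^▷ m)` on horizontal vectors, which is
`Ω ∧^▷ m = ∂(m) ∧^▷ m` and vanishes by antisymmetry of the Peiffer lifting. -/
theorem covD_twoCurvature : B.covD θ (B.twoCurvature θ m) = 0 := by
  funext u
  refine ContinuousAlternatingMap.ext fun (v : Fin 4 → VP) => ?_
  let w : Fin 4 → VP := fun i => B.horProj θ u (v i)
  have hw : ∀ i, B.horProj θ u (w i) = w i := fun i => h.connection.horProj_horProj u (v i)
  let x := extChartAt IP u u
  have hx : x ∈ (extChartAt IP u).target := mem_extChartAt_target u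
  have hm : ContDiffAt ℝ ∞ (m.inChart u) x := h.smooth.contDiffAt_inChart u hx
  have hθ : ContDiffAt ℝ ∞ (θ.linearInChart u) x :=
    (h.connection.smooth.linearInChart u).contDiffAt ((isOpen_extChartAt_target u).mem_nhds hx)
  have hdm : ContDiffAt ℝ ∞ (extDeriv (m.inChart u)) x :=
    ((h.smooth u).extDeriv (isOpen_extChartAt_target u)).contDiffAt
      ((isOpen_extChartAt_target u).mem_nhds hx)
  have hW : ContDiffAt ℝ ∞
      (fun y => wedgeOne X.derivedAct (θ.linearInChart u y) (m.inChart u y)) x :=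
    (ContDiffOn.wedgeOne (h.connection.smooth.linearInChart u) (h.smooth u)).contDiffAt
      ((isOpen_extChartAt_target u).mem_nhds hx)
  have h1 : (B.twoCurvature θ m).inChart u =ᶠ[𝓝 x] fun y => extDeriv (m.inChart u) y +
      wedgeOne X.derivedAct (θ.linearInChart u y) (m.inChart u y) := by
    filter_upwards [(isOpen_extChartAt_target u).eventually_mem hx] with y hy
    exact h.inChart_twoCurvature u hy
  refine ((B.twoCurvature θ m).d_apply u w).trans ?_
  rw [h1.extDeriv_eq, extDeriv_fun_add (hdm.differentiableAt (by simp))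
    (hW.differentiableAt (by simp)), extDeriv_extDeriv_apply hm (by
      rw [minSmoothness_of_isRCLikeNormedField]
      exact WithTop.coe_le_coe.2 le_top), zero_add]
  refine extDeriv_wedgeOne_eq_zero X.derivedAct_dBd_antisymm (hθ.differentiableAt (by simp))
    (hm.differentiableAt (by simp)) w (fun i => ?_) fun i j => ?_
  · rw [DForm.linearInChart_apply]
    exact (θ.inChart_self_apply u _).trans (h.connection.toLinear_horProj u (v i))
  · refine (h.connection.smooth.fderiv_linearInChart_sub u (w i) (w j)).trans ?_
    have h2 : B.curvature θ u ![w i, w j] = θ.d u ![w i, w j] := by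
      refine congrArg (θ.d u : (Fin 2 → VP) → VG) (funext fun k => ?_)
      fin_cases k
      · exact hw i
      · exact hw j
    rw [← h2]
    -- `∂(m) = Ω` relates `dθ` to `m`, as `dθ` and `Ω` agree on horizontal vectors.
    have h3 : X.dBd (m u ![w i, w j]) = B.curvature θ u ![w i, w j] :=
      DFunLike.congr_fun (h.bd_eq_curvature u) ![w i, w j]
    rw [← h3]
    exact congrArg X.dBd (m.inChart_self_apply u ![w i, w j]).symm

include h in
/-- Since `𝓜` is horizontal and equivariant, `d𝓜 + θ ∧^▷ 𝓜 = D𝓜 = 0`. -/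
theorem d_twoCurvature_add_wedge :
    (B.twoCurvature θ m).d + X.wedge θ (B.twoCurvature θ m) = 0 := by
  funext u
  refine ContinuousAlternatingMap.ext fun (v : Fin 4 → VP) => ?_
  have h1 := h.connection.d_apply_of_horizontal X h.isSmooth_twoCurvature
    (h.connection.covD_equivariant X h.smooth h.equivariant)
    (h.connection.compHorizontal_compHorizontal m.d).symm u v
  have h2 : B.covD θ (B.twoCurvature θ m) u v = 0 :=
    DFunLike.congr_fun (congrFun h.covD_twoCurvature u) v
  have h3 : X.wedge θ (B.twoCurvature θ m) u v =
      wedgeOne X.derivedAct (θ.toLinear u) (B.twoCurvature θ m u) v :=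
    (wedgeAlong_one_three_apply X.derivedAct (θ u) (B.twoCurvature θ m u) v).trans
      (wedgeOne_apply (V := VP) X.derivedAct (θ.toLinear u) (B.twoCurvature θ m u) v).symm
  exact (congrArg₂ (· + ·) h1 h3).trans ((sub_add_cancel _ _).trans h2)

end SmoothPrincipalBundle.IsCategoricalConnection

end Bianchi

end

theorem mainTheorem6
    {VG : Type*} [NormedAddCommGroup VG] [NormedSpace ℝ VG] [FiniteDimensional ℝ VG]
    {HG : Type*} [TopologicalSpace HG] (IG : ModelWithCorners ℝ VG HG) [IG.Boundaryless]
    {VE : Type*} [NormedAddCommGroup VE] [NormedSpace ℝ VE] [FiniteDimensional ℝ VE]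
    {HE : Type*} [TopologicalSpace HE] (IE : ModelWithCorners ℝ VE HE) [IE.Boundaryless]
    {VM : Type*} [NormedAddCommGroup VM] [NormedSpace ℝ VM] [FiniteDimensional ℝ VM]
    {HM : Type*} [TopologicalSpace HM] (IM : ModelWithCorners ℝ VM HM) [IM.Boundaryless]
    {VP : Type*} [NormedAddCommGroup VP] [NormedSpace ℝ VP] [FiniteDimensional ℝ VP]
    {HP : Type*} [TopologicalSpace HP] (IP : ModelWithCorners ℝ VP HP) [IP.Boundaryless]
    {G : Type*} [TopologicalSpace G] [ChartedSpace HG G] [Group G] [LieGroup IG ∞ G]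
    {E : Type*} [TopologicalSpace E] [ChartedSpace HE E] [Group E] [LieGroup IE ∞ E]
    {M : Type*} [TopologicalSpace M] [ChartedSpace HM M] [IsManifold IM ∞ M]
    {P : Type*} [TopologicalSpace P] [ChartedSpace HP P] [IsManifold IP ∞ P]
    (X : LieCrossedModule IG IE G E) (B : SmoothPrincipalBundle IG IM IP G M P)
    (θ : DForm IP P VG 1) (m : DForm IP P VE 2) (h : B.IsCategoricalConnection X θ m) :
    (B.twoCurvature θ m).IsSmooth ∧
    B.covD θ (B.twoCurvature θ m) = 0 ∧
    (B.twoCurvature θ m).d + X.wedge θ (B.twoCurvature θ m) = 0 :=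
  ⟨h.isSmooth_twoCurvature, h.covD_twoCurvature, h.d_twoCurvature_add_wedge⟩
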